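/- Let $\mathcal H$ be a complex Hilbert space and $\mathbb N_0=\{0,1,2,\dots\}$. Let $H^2_{\mathcal H}(\mathbb D^2)$ be the Hardy space of functions $f(z)=\sum_{k\in\mathbb N_0^2} f_kz^k$ with $f_k\in\mathcal H$ and $\sum_k\|f_k\|^2<\infty$ (identified with $\ell^2_{\mathcal H}(\mathbb N_0^2)$). For $\Lambda\subseteq\mathbb N_0^2$ let $\Pi_\Lambda$ be the projection $\sum_k f_kz^k\mapsto\sum_{k\in\Lambda}f_kz^k$. For an operator-valued trigonometric polynomial $F(z)=\sum_k F_kz^k$ (a finite sum over $k\in\mathbb Z^2$, with $F_k$ bounded on $\mathcal H$), let $T_F$ be the Toeplitz operator on $H^2_{\mathcal H}(\mathbb D^2)$ with symbol $F$, i.e. with operator matrix $(F_{j-k})_{j,k\in\mathbb N_0^2}$. For a positive semidefinite operator $M$ on $H^2_{\mathcal H}(\mathbb D^2)$, the Schur complement $S(M;\Lambda)$ supported on $\Lambda$, padded with zeros, is the largest (in the Loewner order) operator $X$ with $X=\Pi_\Lambda X\Pi_\Lambda$ and $X\le M$. Let $n_1,n_2\in\mathbb N_0$, $K=\{0,\dots,n_1\}\times\{0,\dots,n_2\}$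 (with $\{0,\dots,-1\}=\emptyset$ below), and let $Q_k:\mathcal H\to\mathcal H$, $k\in K-K$, be bounded operators such that $Q(z):=\sum_{k\in K-K}Q_kz^k\ge 0$ for all $z\in\mathbb T^2$. Put $$S_1=S(T_Q;\{0,\dots,n_1-1\}\times\{0,\dots,n_2\}),\quad S_2=S(T_Q;\{0,\dots,n_1\}\times\{0,\dots,n_2-1\}),$$ $$S_0=S(T_Q;\{0,\dots,n_1-1\}\times\{0,\dots,n_2-1\}),$$ and let $T_i$, $i=1,2$, be the operator of multiplication by $z_i$ on $H^2_{\mathcal H}(\mathbb D^2)$. **(a)** Suppose that $Q(z)=P(z)^*P(z)$, $z\in\mathbb T^2$, where $P(z)=\sum_{k\in K}P_kz^k$ with $P_k$ bounded on $\mathcal H$ satisfies $$\operatorname{ran}\,\Pi_{\mathbb N_0^2\setminus\widetilde K}T_P\Pi_{\widetilde K}\subseteq\overline{\operatorname{ran}}\,\Pi_{\mathbb N_0^2\setminus\widetilde K}T_P\Pi_{\mathbb N_0^2\setminus\widetilde K}$$ for each of the four sets $\widetilde K=\{0,\dots,n_1-1\}\times\{0,\dots,n_2-1\}$, $\{0,\dots,n_1\}\times\{0,\dots,n_2-1\}$,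 $K\setminus\{(n_1,n_2)\}$ and $K$. Then $$S(T_Q;K\setminus\{(n_1,n_2)\})=S_1+S_2-S_0\qquad(1)$$ and $$S(T_Q;K)=T_Q-T_1(T_Q-S_1)T_1^*-T_2(T_Q-S_2)T_2^*+T_1T_2(T_Q-S_0)T_2^*T_1^*.\qquad(2)$$ **(b)** Conversely, suppose that (1) and (2) hold. Then there exists an operator-valued polynomial $P(z)=\sum_{k\in K}P_kz^k$, with $P_k$ bounded on $\mathcal H$, such that $Q(z)=P(z)^*P(z)$ for all $z\in\mathbb T^2$, $$\operatorname{ran}\,\Pi_{\mathbb N_0^2\setminus K}T_P\Pi_{\{(n_1,n_2)\}}\subseteq\overline{\operatorname{ran}}\,\Pi_{\mathbb N_0^2\setminus K}T_P\Pi_{\mathbb N_0^2\setminus K},$$ and $\operatorname{ran}P_k\subseteq\overline{\operatorname{ran}}\,P_0$ for all $k\in K$. -/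

import Mathlib

open scoped Pointwise

noncomputable section

namespace TwoVarOuter

/-! ### Schur complements of positive operators -/

section Schur

variable {E : Type*} [NormedAddCommGroup E] [InnerProductSpace ℂ E] [CompleteSpace E]

/-- `S` is the Schur complement of `M` supported on the range of the orthogonal projection `p`:
the largest operator `S`, in the Loewner order, that lives on the range of `p`
(that is, `S = p S p`, so that `S` is a corner padded with zeros) and satisfies `S ≤ M`. -/
def IsSchurComplement (M p S : E →L[ℂ] E) : Prop :=
  IsGreatest {X : E →L[ℂ] E | p * X * p = X ∧ X ≤ M} S

/-- For positive semidefinite `M` the Schur complement exists. -/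
theorem exists_isSchurComplement {M p : E →L[ℂ] E} (hM : 0 ≤ M) (hp : IsStarProjection p) :
    ∃ S, IsSchurComplement M p S := by
  set R : E →L[ℂ] E := CFC.sqrt M with hR
  have hR0 : 0 ≤ R := CFC.sqrt_nonneg M
  have hRR : R * R = M := CFC.sqrt_mul_sqrt_self M hM
  have hRs : star R = R := (IsSelfAdjoint.of_nonneg hR0).star_eq
  have hps : star p = p := hp.isSelfAdjoint.star_eq
  have hpp : p * p = p := hp.isIdempotentElem.eq
  set q : E →L[ℂ] E := 1 - p with hq
  have hqs : star q = q := by simp [hq, hps]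
  have hpq : p * q = 0 := by rw [hq, mul_sub, hpp, mul_one, sub_self]
  let W : Submodule ℂ E := (LinearMap.range ((R * q : E →L[ℂ] E) : E →ₗ[ℂ] E)).topologicalClosure
  have : CompleteSpace W := (Submodule.isClosed_topologicalClosure _).completeSpace_coe
  let L : E →L[ℂ] E := W.starProjection
  have hLproj : IsStarProjection L := isStarProjection_starProjection
  have hLs : star L = L := hLproj.isSelfAdjoint.star_eq
  have hLL : L * L = L := hLproj.isIdempotentElem.eq
  have hL : L * (R * q) = R * q := by
    ext x
    exact Submodule.starProjection_eq_self_iff.mpr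
      (Submodule.le_topologicalClosure _ (LinearMap.mem_range_self _ x))
  set S : E →L[ℂ] E := R * (1 - L) * R with hS
  have hSq : S * q = 0 := by
    rw [hS, show R * (1 - L) * R * q = R * (R * q - L * (R * q)) by noncomm_ring, hL]
    simp
  have hSs : star S = S := by
    simp [hS, hRs, hLs, mul_assoc]
  have hqS : q * S = 0 := by
    have := congrArg star hSq
    simpa [hSs, hqs] using this
  have hpS : p * S * p = S := by
    have h1 : p * S = S := by
      have : (1 - q) * S = S := by rw [sub_mul, hqS]; simp
      simpa [hq] using this
    have h2 : S * p = S := by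
      have : S * (1 - q) = S := by rw [mul_sub, hSq]; simp
      simpa [hq] using this
    rw [h1, h2]
  refine ⟨S, ⟨hpS, ?_⟩, ?_⟩
  · have : M - S = star (L * R) * (L * R) := by
      rw [hS, ← hRR, star_mul, hRs, hLs,
        show R * L * (L * R) = R * (L * L) * R by noncomm_ring, hLL]
      noncomm_ring
    rw [← sub_nonneg, this]
    exact star_mul_self_nonneg _
  · rintro X ⟨hX1, hX2⟩
    have hXM : (M - X).IsPositive := (ContinuousLinearMap.le_def _ _).1 hX2
    have hMs : IsSelfAdjoint M := IsSelfAdjoint.of_nonneg hM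
    have hXs : IsSelfAdjoint X := by
      have := hMs.sub hXM.isSelfAdjoint
      simpa using this
    have hXq : X * q = 0 := by rw [← hX1, mul_assoc, hpq, mul_zero]
    have hSsa : IsSelfAdjoint S := hSs
    have hqX : q * X = 0 := by
      have := congrArg star hXq
      simpa [hXs.star_eq, hqs] using this
    rw [ContinuousLinearMap.le_def, ContinuousLinearMap.isPositive_def']
    refine ⟨hSsa.sub hXs, fun x => ?_⟩
    have key : ∀ w ∈ W, X.reApplyInnerSelf x ≤ ‖R x - w‖ ^ 2 := by
      intro w hw
      have hcl : IsClosed {w : E | X.reApplyInnerSelf x ≤ ‖R x - w‖ ^ 2} :=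
        isClosed_le continuous_const (by fun_prop)
      have hsub : (LinearMap.range ((R * q : E →L[ℂ] E) : E →ₗ[ℂ] E) : Set E) ⊆
          {w : E | X.reApplyInnerSelf x ≤ ‖R x - w‖ ^ 2} := by
        rintro _ ⟨y, rfl⟩
        have h1 := hXM.re_inner_nonneg_left (x - q y)
        have hXx : X (x - q y) = X x := by
          have : X (q y) = 0 := DFunLike.congr_fun hXq y
          rw [map_sub, this, sub_zero]
        have hXi : inner ℂ (X x) (q y) = 0 := by
          have : q (X x) = 0 := DFunLike.congr_fun hqX x
          rw [← hqs, ContinuousLinearMap.star_eq_adjoint,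
            ContinuousLinearMap.adjoint_inner_right, this, inner_zero_left]
        have hMi : inner ℂ (M (x - q y)) (x - q y) = inner ℂ (R (x - q y)) (R (x - q y)) := by
          have hR2 : M (x - q y) = R (R (x - q y)) := (DFunLike.congr_fun hRR (x - q y)).symm
          rw [hR2]
          nth_rewrite 1 [← hRs]
          rw [ContinuousLinearMap.star_eq_adjoint, ContinuousLinearMap.adjoint_inner_left]
        rw [sub_apply, inner_sub_left, hMi, hXx, inner_sub_right (X x), hXi,
          sub_zero, map_sub, inner_self_eq_norm_sq, map_sub R] at h1
        simpa [ContinuousLinearMap.reApplyInnerSelf] using h1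
      exact (hcl.closure_subset_iff.2 hsub) hw
    have h2 := key (L (R x)) (W.starProjection_apply_mem _)
    have h3 : S.reApplyInnerSelf x = ‖R x - L (R x)‖ ^ 2 := by
      have hS2 : S = star ((1 - L) * R) * ((1 - L) * R) := by
        rw [hS, star_mul, hRs, star_sub, star_one, hLs,
          show R * (1 - L) * ((1 - L) * R) = R * (1 - L - L + L * L) * R by noncomm_ring, hLL]
        noncomm_ring
      rw [ContinuousLinearMap.reApplyInnerSelf, hS2, ContinuousLinearMap.star_eq_adjoint,
        mul_apply_eq_comp, ContinuousLinearMap.adjoint_inner_left, inner_self_eq_norm_sq]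
      rfl
    have h4 : (S - X).reApplyInnerSelf x = S.reApplyInnerSelf x - X.reApplyInnerSelf x := by
      simp [ContinuousLinearMap.reApplyInnerSelf, inner_sub_left]
    rw [h4, h3]
    linarith

open Classical in
/-- The Schur complement of `M` supported on the range of `p`; see `schur_isSchurComplement`. -/
def schur (M p : E →L[ℂ] E) : E →L[ℂ] E :=
  if h : ∃ S, IsSchurComplement M p S then h.choose else 0

theorem schur_isSchurComplement {M p : E →L[ℂ] E} (hM : 0 ≤ M) (hp : IsStarProjection p) :
    IsSchurComplement M p (schur M p) := by
  have h := exists_isSchurComplement hM hp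
  rw [schur, dif_pos h]
  exact h.choose_spec

end Schur

/-! ### The Hardy space of the bidisk and its operators -/

variable {H : Type*} [NormedAddCommGroup H] [InnerProductSpace ℂ H]

/-- The Hardy space `H²_H(𝔻²)`: a function `f(z) = ∑ f_k z^k`, `k ∈ ℕ²`, is identified with its
square summable family of Taylor coefficients `f_k ∈ H`. -/
abbrev Hardy (H : Type*) [NormedAddCommGroup H] : Type _ := lp (fun _ : ℕ × ℕ => H) 2

open Classical in
/-- The family `k ↦ A (f (σ k))` for `k ∈ D`, and `0` off `D`. -/
def reindexFun (D : Set (ℕ × ℕ)) (σ : ℕ × ℕ → ℕ × ℕ) (A : H →L[ℂ] H) (f : ℕ × ℕ → H) :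
    ℕ × ℕ → H :=
  fun k => if k ∈ D then A (f (σ k)) else 0

theorem reindexFun_sum_le {D : Set (ℕ × ℕ)} {σ : ℕ × ℕ → ℕ × ℕ} (hσ : Set.InjOn σ D)
    (A : H →L[ℂ] H) (f : Hardy H) (s : Finset (ℕ × ℕ)) :
    ∑ k ∈ s, ‖reindexFun D σ A f k‖ ^ (2 : ENNReal).toReal
      ≤ (‖A‖ * ‖f‖) ^ (2 : ENNReal).toReal := by
  classical
  have h2 : (0 : ℝ) < (2 : ENNReal).toReal := by norm_num
  rw [Real.mul_rpow (norm_nonneg _) (norm_nonneg _)]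
  calc ∑ k ∈ s, ‖reindexFun D σ A f k‖ ^ (2 : ENNReal).toReal
      = ∑ k ∈ s with k ∈ D, ‖A (f (σ k))‖ ^ (2 : ENNReal).toReal := by
        rw [Finset.sum_filter]
        refine Finset.sum_congr rfl fun k _ => ?_
        by_cases hk : k ∈ D <;> simp [reindexFun, hk]
    _ ≤ ∑ k ∈ s with k ∈ D, ‖A‖ ^ (2 : ENNReal).toReal * ‖f (σ k)‖ ^ (2 : ENNReal).toReal := by
        refine Finset.sum_le_sum fun k _ => ?_
        rw [← Real.mul_rpow (norm_nonneg _) (norm_nonneg _)]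
        exact Real.rpow_le_rpow (norm_nonneg _) (A.le_opNorm _) h2.le
    _ = ‖A‖ ^ (2 : ENNReal).toReal *
          ∑ k ∈ (s.filter (· ∈ D)).image σ, ‖f k‖ ^ (2 : ENNReal).toReal := by
        rw [Finset.sum_image, Finset.mul_sum]
        intro a ha b hb hab
        exact hσ (by simpa using (Finset.mem_filter.1 ha).2)
          (by simpa using (Finset.mem_filter.1 hb).2) hab
    _ ≤ _ := by
        gcongr
        exact lp.sum_rpow_le_norm_rpow h2 f _

/-- `reindexFun` as a bounded operator on the Hardy space. -/
def reindex (D : Set (ℕ × ℕ)) (σ : ℕ × ℕ → ℕ × ℕ) (hσ : Set.InjOn σ D) (A : H →L[ℂ] H) :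
    Hardy H →L[ℂ] Hardy H :=
  LinearMap.mkContinuous
    { toFun := fun f => ⟨reindexFun D σ A f, memℓp_gen' (reindexFun_sum_le hσ A f)⟩
      map_add' := fun f g => by
        ext k
        change reindexFun D σ A (f + g : Hardy H) k =
          reindexFun D σ A f k + reindexFun D σ A g k
        by_cases hk : k ∈ D <;> simp [reindexFun, hk]
      map_smul' := fun c f => by
        ext k
        by_cases hk : k ∈ D <;> simp [reindexFun, hk] }
    ‖A‖ fun f => lp.norm_le_of_forall_sum_le (by norm_num) (by positivity)
      (reindexFun_sum_le hσ A f)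

/-- The projection `Π_Λ (∑ f_k z^k) = ∑_{k ∈ Λ} f_k z^k`. -/
def proj (Λ : Set (ℕ × ℕ)) : Hardy H →L[ℂ] Hardy H :=
  reindex Λ id (Set.injOn_id _) 1

open Classical in
theorem proj_apply (Λ : Set (ℕ × ℕ)) (f : Hardy H) (k : ℕ × ℕ) :
    (proj Λ f : Hardy H) k = if k ∈ Λ then f k else 0 := rfl

theorem proj_isStarProjection [CompleteSpace H] (Λ : Set (ℕ × ℕ)) :
    IsStarProjection (proj Λ : Hardy H →L[ℂ] Hardy H) := by
  classical
  refine ⟨?_, ?_⟩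
  · ext f k
    by_cases hk : k ∈ Λ <;> simp [proj_apply, hk]
  · rw [ContinuousLinearMap.isSelfAdjoint_iff_isSymmetric]
    intro f g
    simp only [ContinuousLinearMap.coe_coe, lp.inner_eq_tsum]
    refine tsum_congr fun k => ?_
    by_cases hk : k ∈ Λ <;> simp [proj_apply, hk]

/-- The inclusion `ℕ² ⊆ ℤ²`. -/
def ι (k : ℕ × ℕ) : ℤ × ℤ := (k.1, k.2)

/-- A trigonometric polynomial `Q(z) = ∑ Q_k z^k` in two variables with operator coefficients
`Q_k`, given by its finitely supported family of coefficients. It is an (analytic) polynomial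
when all `k` with `Q_k ≠ 0` lie in `ℕ²`. -/
abbrev TrigPoly (H : Type*) [NormedAddCommGroup H] [InnerProductSpace ℂ H] : Type _ :=
  (ℤ × ℤ) →₀ (H →L[ℂ] H)

/-- The value `Q(z) = ∑ Q_k z₁^{k₁} z₂^{k₂}` at `z ∈ 𝕋²`. -/
def TrigPoly.eval (Q : TrigPoly H) (z : Circle × Circle) : H →L[ℂ] H :=
  Q.sum fun k A => ((z.1 : ℂ) ^ k.1 * (z.2 : ℂ) ^ k.2) • A

theorem shift_injOn (m : ℤ × ℤ) :
    Set.InjOn (fun j : ℕ × ℕ => ((ι j - m).1.toNat, (ι j - m).2.toNat)) {j | 0 ≤ ι j - m} := by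
  rintro ⟨a, b⟩ ⟨h1, h2⟩ ⟨c, d⟩ ⟨h3, h4⟩ h
  simp only [ι, Prod.fst_sub, Prod.snd_sub, Prod.fst_zero, Prod.snd_zero, Prod.mk.injEq] at *
  omega

/-- The Toeplitz operator `T_Q f = Π₊ (Q f)` on the Hardy space: the `j`-th coefficient of `T_Q f`
is the sum of `Q_m f_{j-m}` over all `m` with `j - m ∈ ℕ²`. For an analytic polynomial this is
multiplication by `Q`. -/
def toeplitz (Q : TrigPoly H) : Hardy H →L[ℂ] Hardy H :=
  Q.sum fun m A => reindex {j | 0 ≤ ι j - m} _ (shift_injOn m) A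

/-- The matrix of `T_Q` is `(Q_{j-k})_{j,k ∈ ℕ²}`. -/
theorem toeplitz_single (Q : TrigPoly H) (j k : ℕ × ℕ) (h : H) :
    (toeplitz Q (lp.single 2 k h) : Hardy H) j = Q (ι j - ι k) h := by
  classical
  have hrow : (toeplitz Q (lp.single 2 k h) : Hardy H) j =
      Q.sum fun m A => reindexFun {j | 0 ≤ ι j - m}
        (fun j => ((ι j - m).1.toNat, (ι j - m).2.toNat)) A (lp.single 2 k h : Hardy H) j := by
    simp only [toeplitz, Finsupp.sum, sum_apply, lp.coeFn_sum,
      Finset.sum_apply]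
    rfl
  have hterm : ∀ (m : ℤ × ℤ) (A : H →L[ℂ] H), reindexFun {j | 0 ≤ ι j - m}
        (fun j => ((ι j - m).1.toNat, (ι j - m).2.toNat)) A (lp.single 2 k h : Hardy H) j =
      if m = ι j - ι k then A h else 0 := by
    intro m A
    by_cases hj : j ∈ {j : ℕ × ℕ | 0 ≤ ι j - m}
    · rw [reindexFun, if_pos hj, lp.single_apply, Pi.single_apply]
      have hiff : ((ι j - m).1.toNat, (ι j - m).2.toNat) = k ↔ m = ι j - ι k := by
        obtain ⟨h1, h2⟩ := hj
        rw [Prod.ext_iff, Prod.ext_iff]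
        simp only [ι, Prod.fst_sub, Prod.snd_sub, Prod.fst_zero, Prod.snd_zero] at *
        omega
      simp only [hiff]
      split_ifs <;> simp
    · rw [reindexFun, if_neg hj, if_neg]
      rintro rfl
      apply hj
      simp [ι, Prod.le_def]
  rw [hrow, Finsupp.sum]
  simp only [hterm]
  rw [Finset.sum_ite_eq']
  split_ifs with hm
  · rfl
  · rw [Finsupp.notMem_support_iff.1 hm]; rfl

/-- The rectangle `{0, …, a - 1} × {0, …, b - 1}`. -/
def rect (a b : ℕ) : Set (ℕ × ℕ) := {k | k.1 < a ∧ k.2 < b}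

/-- The Schur complement `S(T_Q; Λ)`, padded with zeros to an operator on the Hardy space. -/
def schurT [CompleteSpace H] (Q : TrigPoly H) (Λ : Set (ℕ × ℕ)) : Hardy H →L[ℂ] Hardy H :=
  schur (toeplitz Q) (proj Λ)

/-- The inclusion `ran (Π_{ℕ² ∖ Λ} T_P Π_Γ) ⊆ closure (ran (Π_{ℕ² ∖ Λ} T_P Π_{ℕ² ∖ Λ}))`. -/
def RangeCond (P : TrigPoly H) (Λ Γ : Set (ℕ × ℕ)) : Prop :=
  Set.range (proj Λᶜ * toeplitz P * proj Γ : Hardy H →L[ℂ] Hardy H) ⊆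
    closure (Set.range (proj Λᶜ * toeplitz P * proj Λᶜ : Hardy H →L[ℂ] Hardy H))

end TwoVarOuter

end

open TwoVarOuter

open TwoVarOuter

noncomputable section

namespace TwoVarOuter

/-! ### Schur complements through quadratic forms, and factoring of positive operators. -/

section Operators

variable {E F : Type*} [NormedAddCommGroup E] [InnerProductSpace ℂ E] [CompleteSpace E]
  [NormedAddCommGroup F] [InnerProductSpace ℂ F] [CompleteSpace F]

/-! The quadratic form of the Schur complement `S(M; Λ)` at `f` is the infimum of the form of `M`
over `f - g` with `g` vanishing on `Λ`. Both directions rest on this.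

(a) A factorization gives `T_Q = T_P^* T_P`, and `T_P` is lower triangular for every lower set `Λ`.
The form of `T_Q` at `f - g` then splits into a part on `Λ` independent of `g` and a remainder
outside `Λ`. The range condition makes the remainder arbitrarily small, so `S(T_Q; Λ) = T_P^* Π_Λ
T_P` (`IsSchurComplement.of_approx`). For the rectangle of `S₁` this formula comes from that of `K`
without its corner: reading the range condition at the corner gives `ran P_a ⊆ closure (ran P_0)`,
which allows the points of the last column to be removed one at a time. Identity (1) is then
inclusion-exclusion for projections, and (2) is an identity between indicator functions, compared
entry by entry.

(b) Let `c = (n₁, n₂)`. Passing from `K` to `K \ {c}` minimizes over the single coefficient at `c`,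
so the positive operator `S(T_Q; K) - S(T_Q; K \ {c})` is `R^* R` for some `R` with values in `H`
and range in the closure of `R` applied to monomials at `c` (`exists_row`). The coefficients of `P`
are the entries of the row `R` in reversed order. Summing (2) minus (1) along the diagonal `j - k =
d` of `K × K`, each shifted `S_i` cancels the unshifted one, and the Toeplitz terms leave exactly
one copy of `Q_d`; hence `Q = P^* P` (`eq_gram_rowPoly`). The range condition at `c` follows because
the infimum defining `S(T_Q; K)` at `h z^c` equals `‖P_0 h‖²`, which the coefficient at `c` already
accounts for (`rangeCond_corner`). -/

omit [CompleteSpace E] in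
theorem reApplyInnerSelf_mono {X Y : E →L[ℂ] E} (h : X ≤ Y) (f : E) :
    X.reApplyInnerSelf f ≤ Y.reApplyInnerSelf f := by
  have := ((ContinuousLinearMap.le_def _ _).1 h).re_inner_nonneg_left f
  simp only [sub_apply, inner_sub_left, map_sub] at this
  simpa [ContinuousLinearMap.reApplyInnerSelf] using this

theorem le_of_reApplyInnerSelf_le {X Y : E →L[ℂ] E} (hX : IsSelfAdjoint X) (hY : IsSelfAdjoint Y)
    (h : ∀ f, X.reApplyInnerSelf f ≤ Y.reApplyInnerSelf f) : X ≤ Y := by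
  rw [ContinuousLinearMap.le_def, ContinuousLinearMap.isPositive_def']
  refine ⟨hY.sub hX, fun f => ?_⟩
  have := h f
  simp only [ContinuousLinearMap.reApplyInnerSelf, sub_apply, inner_sub_left, map_sub] at this ⊢
  linarith

theorem reApplyInnerSelf_adjoint_comp (A : E →L[ℂ] F) (f : E) :
    (A.adjoint ∘L A).reApplyInnerSelf f = ‖A f‖ ^ 2 := by
  rw [ContinuousLinearMap.reApplyInnerSelf, ContinuousLinearMap.comp_apply,
    ContinuousLinearMap.adjoint_inner_left, inner_self_eq_norm_sq]

theorem reApplyInnerSelf_star_mul (A : E →L[ℂ] E) (f : E) :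
    (star A * A).reApplyInnerSelf f = ‖A f‖ ^ 2 :=
  reApplyInnerSelf_adjoint_comp A f

theorem inner_starProjection_comm {p : E →L[ℂ] E} (hp : IsStarProjection p) (x y : E) :
    inner ℂ (p x) y = inner ℂ x (p y) := by
  nth_rewrite 1 [← hp.isSelfAdjoint.star_eq]
  rw [ContinuousLinearMap.star_eq_adjoint, ContinuousLinearMap.adjoint_inner_left]

theorem star_mul_proj_mul {p : E →L[ℂ] E} (hp : IsStarProjection p) (T : E →L[ℂ] E) :
    star T * p * T = star (p * T) * (p * T) := by
  rw [star_mul, hp.isSelfAdjoint.star_eq, show star T * p * (p * T) = star T * (p * p) * T by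
    noncomm_ring, hp.isIdempotentElem.eq]

omit [CompleteSpace E] in
theorem IsSchurComplement.nonneg {M p S : E →L[ℂ] E} (hM : 0 ≤ M)
    (hS : IsSchurComplement M p S) : 0 ≤ S :=
  hS.2 ⟨by simp, hM⟩

-- Taking Schur complements in stages: a competitor for `p` is also a competitor for `q`, so it lies
-- below `S` as soon as it lies below `M`.
omit [CompleteSpace E] in
theorem IsSchurComplement.nested {M p q S S' : E →L[ℂ] E} (hp : p * q = p) (hp' : q * p = p)
    (hS : IsSchurComplement M q S) (hS' : IsSchurComplement M p S') :
    IsSchurComplement S p S' := by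
  refine ⟨⟨hS'.1.1, hS.2 ⟨?_, hS'.1.2⟩⟩, fun X hX => hS'.2 ⟨hX.1, hX.2.trans hS.1.2⟩⟩
  rw [← hS'.1.1, show q * (p * S' * p) * q = (q * p) * S' * (p * q) by noncomm_ring, hp, hp']

/-- The quadratic form of the Schur complement is an infimum of values of the quadratic form
of `M`. -/
theorem IsSchurComplement.exists_lt {M p S : E →L[ℂ] E} (hM : 0 ≤ M) (hp : IsStarProjection p)
    (hS : IsSchurComplement M p S) (f : E) {ε : ℝ} (hε : 0 < ε) :
    ∃ g, p g = 0 ∧ M.reApplyInnerSelf (f - g) < S.reApplyInnerSelf f + ε := by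
  set R : E →L[ℂ] E := CFC.sqrt M with hR
  have hRR : R * R = M := CFC.sqrt_mul_sqrt_self M hM
  have hRs : star R = R := (IsSelfAdjoint.of_nonneg (CFC.sqrt_nonneg M)).star_eq
  have hps : star p = p := hp.isSelfAdjoint.star_eq
  have hpp : p * p = p := hp.isIdempotentElem.eq
  set q : E →L[ℂ] E := 1 - p with hq
  have hqs : star q = q := by simp [hq, hps]
  let W : Submodule ℂ E := (LinearMap.range ((R * q : E →L[ℂ] E) : E →ₗ[ℂ] E)).topologicalClosure
  have : CompleteSpace W := (Submodule.isClosed_topologicalClosure _).completeSpace_coe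
  let L : E →L[ℂ] E := W.starProjection
  have hLproj : IsStarProjection L := isStarProjection_starProjection
  have hL1 : IsStarProjection (1 - L) := hLproj.one_sub
  have hL : L * (R * q) = R * q := by
    ext x
    exact Submodule.starProjection_eq_self_iff.mpr
      (Submodule.le_topologicalClosure _ (LinearMap.mem_range_self _ x))
  set X : E →L[ℂ] E := star R * (1 - L) * R with hX
  have hX' : X = star ((1 - L) * R) * ((1 - L) * R) := star_mul_proj_mul hL1 R
  have hXs : star X = X := by rw [hX', star_mul, star_star]
  have hXq : X * q = 0 := by
    rw [hX, show star R * (1 - L) * R * q = star R * (R * q - L * (R * q)) by noncomm_ring, hL]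
    simp
  have hqX : q * X = 0 := by
    have := congrArg star hXq
    simpa [hXs, hqs] using this
  have hpX : p * X * p = X := by
    have h1 : p * X = X := by
      have : (1 - q) * X = X := by rw [sub_mul, hqX]; simp
      simpa [hq] using this
    have h2 : X * p = X := by
      have : X * (1 - q) = X := by rw [mul_sub, hXq]; simp
      simpa [hq] using this
    rw [h1, h2]
  have hXM : X ≤ M := by
    have : M - X = star (L * R) * (L * R) := by
      rw [← star_mul_proj_mul hLproj, hX, ← hRR, hRs]
      noncomm_ring
    rw [← sub_nonneg, this]
    exact star_mul_self_nonneg _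
  -- `X` is a competitor whose form at `f` is the squared distance from `R f` to the closed range of
  -- `R q`. Maximality of `S` bounds that distance, and a nearby point of the range yields `g`.
  have hle := reApplyInnerSelf_mono (hS.2 ⟨hpX, hXM⟩) f
  rw [hX', reApplyInnerSelf_star_mul] at hle
  have hcont : Continuous fun w : E => ‖R f - w‖ ^ 2 := by fun_prop
  have hmem : L (R f) ∈ closure (Set.range (R * q : E →L[ℂ] E)) :=
    W.starProjection_apply_mem (R f)
  have hlt : ‖R f - L (R f)‖ ^ 2 < S.reApplyInnerSelf f + ε := lt_of_le_of_lt hle (by linarith)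
  obtain ⟨_, hw, ⟨y, rfl⟩⟩ := mem_closure_iff.1 hmem _ (isOpen_lt hcont continuous_const) hlt
  refine ⟨q y, ?_, ?_⟩
  · have : p * q = 0 := by rw [hq, mul_sub, hpp, mul_one, sub_self]
    exact DFunLike.congr_fun this y
  · rw [← hRR]
    nth_rewrite 1 [← hRs]
    rw [reApplyInnerSelf_star_mul, map_sub]
    exact hw

/-- Passing from `q` to a smaller projection `p`, for an operator `T` which is lower triangular
with respect to `p`. -/
theorem IsSchurComplement.of_approx {M p q T : E →L[ℂ] E} (hp : IsStarProjection p)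
    (hq : IsStarProjection q) (hpq : p * q = p)
    (hS : IsSchurComplement M q (star T * q * T)) (hT : p * T * p = p * T)
    (happrox : ∀ f, ((q - p) * T * p) f ∈ closure (((q - p) * T : E →L[ℂ] E) '' {g | p g = 0})) :
    IsSchurComplement M p (star T * p * T) := by
  have hps : star p = p := hp.isSelfAdjoint.star_eq
  have hqs : star q = q := hq.isSelfAdjoint.star_eq
  have hpp : p * p = p := hp.isIdempotentElem.eq
  have hqp : q * p = p := by
    have := congrArg star hpq
    simpa [hps, hqs] using this
  have hpyth : ∀ x, ‖q x‖ ^ 2 = ‖p x‖ ^ 2 + ‖(q - p) x‖ ^ 2 := by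
    intro x
    have h0 : inner ℂ (p x) ((q - p) x) = 0 := by
      rw [inner_starProjection_comm hp, sub_apply, map_sub,
        show p (q x) = p x from DFunLike.congr_fun hpq x,
        show p (p x) = p x from DFunLike.congr_fun hpp x, sub_self, inner_zero_right]
    have := norm_add_sq_eq_norm_sq_add_norm_sq_of_inner_eq_zero (p x) ((q - p) x) h0
    rw [show p x + (q - p) x = q x by simp] at this
    nlinarith
  have hTs : star T * p = p * star T * p := by
    have := congrArg star hT
    simpa [hps, mul_assoc] using this.symm
  refine ⟨⟨?_, ?_⟩, ?_⟩
  · rw [show p * (star T * p * T) * p = (p * star T * p) * T * p by noncomm_ring, ← hTs,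
      show star T * p * T * p = star T * (p * T * p) by noncomm_ring, hT, mul_assoc]
  · refine le_trans ?_ hS.1.2
    refine le_of_reApplyInnerSelf_le ?_ ?_ fun f => ?_
    · rw [star_mul_proj_mul hp]; exact IsSelfAdjoint.star_mul_self _
    · rw [star_mul_proj_mul hq]; exact IsSelfAdjoint.star_mul_self _
    · rw [star_mul_proj_mul hp, star_mul_proj_mul hq, reApplyInnerSelf_star_mul,
        reApplyInnerSelf_star_mul, mul_apply_eq_comp, mul_apply_eq_comp, hpyth (T f)]
      have := sq_nonneg ‖(q - p) (T f)‖
      linarith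
  · rintro Y ⟨hY, hYM⟩
    have hqY : q * Y * q = Y := by
      rw [← hY, show q * (p * Y * p) * q = (q * p) * Y * (p * q) by noncomm_ring, hpq, hqp]
    have hYS : Y ≤ star T * q * T := hS.2 ⟨hqY, hYM⟩
    have hSs : ∀ {r : E →L[ℂ] E}, IsStarProjection r → IsSelfAdjoint (star T * r * T) := by
      intro r hr; rw [star_mul_proj_mul hr]; exact IsSelfAdjoint.star_mul_self _
    have hYs : IsSelfAdjoint Y := by
      have := (hSs hq).sub ((ContinuousLinearMap.le_def _ _).1 hYS).isSelfAdjoint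
      simpa using this
    refine le_of_reApplyInnerSelf_le hYs (hSs hp) fun x => ?_
    rw [star_mul_proj_mul hp, reApplyInnerSelf_star_mul, ← hT]
    have hYx : Y.reApplyInnerSelf x = Y.reApplyInnerSelf (p x) := by
      rw [ContinuousLinearMap.reApplyInnerSelf, ContinuousLinearMap.reApplyInnerSelf]
      nth_rewrite 1 [← hY]
      rw [mul_apply_eq_comp, mul_apply_eq_comp, inner_starProjection_comm hp]
    rw [hYx]
    set f := p x with hf
    -- The form of `Y` does not change under `f ↦ f - g` for `p g = 0`, and triangularity keeps `p T
    -- f` fixed as well. Only the `q - p` part moves, and by hypothesis it can be approximated away;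
    -- the bound passes to the closure.
    have hcl : IsClosed {w : E | Y.reApplyInnerSelf f ≤ ‖p (T f)‖ ^ 2 +
        ‖(q - p) (T f) - w‖ ^ 2} := isClosed_le continuous_const (by fun_prop)
    have hsub : ((q - p) * T : E →L[ℂ] E) '' {g | p g = 0} ⊆
        {w : E | Y.reApplyInnerSelf f ≤ ‖p (T f)‖ ^ 2 + ‖(q - p) (T f) - w‖ ^ 2} := by
      rintro _ ⟨g, hg, rfl⟩
      have hg' : p g = 0 := hg
      have hYg : Y g = 0 := by rw [← hY, mul_apply_eq_comp, hg', map_zero]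
      have hYfg : inner ℂ (Y f) g = 0 := by
        rw [← hY, mul_apply_eq_comp, mul_apply_eq_comp, inner_starProjection_comm hp, hg',
          inner_zero_right]
      have h1 : Y.reApplyInnerSelf (f - g) = Y.reApplyInnerSelf f := by
        simp [ContinuousLinearMap.reApplyInnerSelf, hYg, inner_sub_right, hYfg]
      have h2 := reApplyInnerSelf_mono hYS (f - g)
      have hpTg : p (T g) = 0 := by
        have := DFunLike.congr_fun hT g
        rw [mul_apply_eq_comp, hg', map_zero] at this
        exact this.symm
      rw [star_mul_proj_mul hq, reApplyInnerSelf_star_mul, h1, mul_apply_eq_comp, hpyth, map_sub T,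
        map_sub p, hpTg, sub_zero, map_sub (q - p)] at h2
      exact h2
    have h := hcl.closure_subset_iff.2 hsub (happrox x)
    simp only [Set.mem_ofPred_eq, mul_apply_eq_comp, ← hf, sub_self, norm_zero] at h
    simpa using h

omit [CompleteSpace E] in
theorem isSchurComplement_one (M : E →L[ℂ] E) : IsSchurComplement M 1 M :=
  ⟨⟨by simp, le_rfl⟩, fun _ hX => hX.2⟩

/-- A positive operator whose square root has range approximated from the range of `i` factors
through the domain of `i`. -/
theorem exists_adjoint_comp_self_eq {N : E →L[ℂ] E} (hN : 0 ≤ N) (i : F →L[ℂ] E)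
    (happrox : ∀ f, ∀ ε > 0, ∃ h, N.reApplyInnerSelf (f - i h) < ε) :
    ∃ R : E →L[ℂ] F, R.adjoint ∘L R = N ∧ ∀ f, R f ∈ closure (Set.range (R ∘L i)) := by
  set A : E →L[ℂ] E := CFC.sqrt N with hA
  have hAA : A * A = N := CFC.sqrt_mul_sqrt_self N hN
  have hAs : star A = A := (IsSelfAdjoint.of_nonneg (CFC.sqrt_nonneg N)).star_eq
  have hNA : N = A.adjoint ∘L A := by
    rw [← ContinuousLinearMap.star_eq_adjoint, hAs]; exact hAA.symm
  set B : F →L[ℂ] E := A ∘L i with hB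
  have hBB : 0 ≤ B.adjoint ∘L B := by
    rw [ContinuousLinearMap.nonneg_iff_isPositive]
    exact ContinuousLinearMap.isPositive_adjoint_comp_self B
  -- Polar decomposition: `‖D h‖ = ‖B h‖`, so `B h ↦ D h` extends to an isometry `V` from the closed
  -- range `W` of `B` into `F`. The hypothesis puts the range of `A` inside `W`, so `R = V A` is
  -- defined and lands in `F` rather than `E`.
  set D : F →L[ℂ] F := CFC.sqrt (B.adjoint ∘L B) with hD
  have hDD : D * D = B.adjoint ∘L B := CFC.sqrt_mul_sqrt_self _ hBB
  have hDs : star D = D := (IsSelfAdjoint.of_nonneg (CFC.sqrt_nonneg _)).star_eq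
  have hDB : ∀ h, ‖D h‖ = ‖B h‖ := by
    intro h
    have h1 := reApplyInnerSelf_star_mul D h
    rw [hDs, hDD, reApplyInnerSelf_adjoint_comp] at h1
    exact ((sq_eq_sq₀ (norm_nonneg _) (norm_nonneg _)).1 h1).symm
  let W : Submodule ℂ E := (LinearMap.range (B : F →ₗ[ℂ] E)).topologicalClosure
  have hBW : ∀ h, B h ∈ W := fun h =>
    Submodule.le_topologicalClosure _ (LinearMap.mem_range_self _ h)
  have hAW : ∀ f, A f ∈ W := by
    intro f
    refine Metric.mem_closure_iff.2 fun ε hε => ?_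
    obtain ⟨h, hh⟩ := happrox f (ε ^ 2) (by positivity)
    refine ⟨B h, ⟨h, rfl⟩, ?_⟩
    rw [hNA, reApplyInnerSelf_adjoint_comp, map_sub] at hh
    rw [dist_eq_norm]
    exact lt_of_pow_lt_pow_left₀ 2 hε.le hh
  let e : F →L[ℂ] W := B.codRestrict W hBW
  have hdense : DenseRange e := by
    intro w
    refine Metric.mem_closure_iff.2 fun ε hε => ?_
    obtain ⟨_, ⟨h, rfl⟩, hh⟩ := Metric.mem_closure_iff.1 w.2 ε hε
    exact ⟨e h, ⟨h, rfl⟩, hh⟩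
  let V : W →L[ℂ] F := LinearMap.extendOfNorm (D : F →ₗ[ℂ] F) (e : F →ₗ[ℂ] W)
  have hVe : ∀ h, V (e h) = D h := fun h =>
    LinearMap.extendOfNorm_eq (f := (D : F →ₗ[ℂ] F)) (e := (e : F →ₗ[ℂ] W)) hdense
      ⟨1, fun x => by rw [one_mul]; exact (hDB x).le⟩ h
  have hVn : ∀ w, ‖V w‖ = ‖w‖ := fun w =>
    hdense.induction (P := fun w => ‖V w‖ = ‖w‖)
      (by rintro _ ⟨h, rfl⟩; rw [hVe]; exact hDB h)
      (isClosed_eq (by fun_prop) (by fun_prop)) w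
  let R : E →L[ℂ] F := V ∘L A.codRestrict W hAW
  have hRi : ∀ h, R (i h) = D h := fun h => hVe h
  refine ⟨R, ?_, fun f => ?_⟩
  · have hRn : ∀ f, ‖R f‖ = ‖A f‖ := fun f => hVn _
    have hpos : ∀ (C : E →L[ℂ] F), IsSelfAdjoint (C.adjoint ∘L C) := fun C =>
      (ContinuousLinearMap.isPositive_adjoint_comp_self C).isSelfAdjoint
    have hpos' : IsSelfAdjoint (A.adjoint ∘L A) :=
      (ContinuousLinearMap.isPositive_adjoint_comp_self A).isSelfAdjoint
    rw [hNA]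
    refine le_antisymm (le_of_reApplyInnerSelf_le (hpos R) hpos' fun f => ?_)
      (le_of_reApplyInnerSelf_le hpos' (hpos R) fun f => ?_) <;>
    rw [reApplyInnerSelf_adjoint_comp, reApplyInnerSelf_adjoint_comp, hRn]
  · have h1 : (A.codRestrict W hAW f) ∈ closure (Set.range e) := hdense _
    have h2 := map_mem_closure V.continuous h1 (t := Set.range (R ∘L i)) (by
      rintro _ ⟨h, rfl⟩
      exact ⟨h, (hRi h).trans (hVe h).symm⟩)
    exact h2

end Operators

/-! ### Constant coefficients of Laurent polynomials on the circle and the torus. -/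

section Fourier

theorem integral_circle_zpow (m : ℤ) :
    ∫ t in (0 : ℝ)..(2 * Real.pi), (Circle.exp t : ℂ) ^ m = if m = 0 then 2 * Real.pi else 0 := by
  have h : ∀ t : ℝ, (Circle.exp t : ℂ) ^ m = Complex.exp (m * Complex.I * t) := by
    intro t
    rw [Circle.coe_exp, ← Complex.exp_int_mul]
    ring_nf
  simp only [h]
  split_ifs with hm
  · simp [hm]
  · have hm' : (m : ℂ) * Complex.I ≠ 0 := by simp [hm]
    rw [integral_exp_mul_complex hm']
    have : (m : ℂ) * Complex.I * ((2 * Real.pi : ℝ) : ℂ) = m * (2 * Real.pi * Complex.I) := by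
      push_cast; ring
    rw [this, Complex.exp_int_mul_two_pi_mul_I]
    simp

/-- The constant coefficient of a Laurent polynomial with nonnegative real part on the circle. -/
theorem re_constCoeff_nonneg {α : Type*} (s : Finset α) (c : α → ℂ) (m : α → ℤ)
    (h : ∀ z : Circle, 0 ≤ (∑ i ∈ s, c i * (z : ℂ) ^ m i).re) :
    0 ≤ (∑ i ∈ s with m i = 0, c i).re := by
  have hcont : ∀ n : ℤ, Continuous fun t : ℝ => (Circle.exp t : ℂ) ^ n := fun n =>
    Continuous.zpow₀ (by simp only [Circle.coe_exp]; fun_prop) n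
      fun t => Or.inl (Circle.coe_ne_zero _)
  have hint : ∫ t in (0 : ℝ)..(2 * Real.pi), ∑ i ∈ s, c i * (Circle.exp t : ℂ) ^ m i =
      (2 * Real.pi : ℝ) * ∑ i ∈ s with m i = 0, c i := by
    rw [intervalIntegral.integral_finsetSum (f := fun i t => c i * (Circle.exp t : ℂ) ^ m i)
      (fun i _ => ((continuous_const.mul (hcont (m i))).intervalIntegrable _ _)),
      Finset.sum_filter, Finset.mul_sum]
    refine Finset.sum_congr rfl fun i _ => ?_
    rw [intervalIntegral.integral_const_mul, integral_circle_zpow]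
    split_ifs <;> push_cast <;> ring
  have hc : Continuous fun t : ℝ => ∑ i ∈ s, c i * (Circle.exp t : ℂ) ^ m i :=
    continuous_finsetSum _ fun i _ => continuous_const.mul (hcont _)
  have hre : ∫ t in (0 : ℝ)..(2 * Real.pi), (∑ i ∈ s, c i * (Circle.exp t : ℂ) ^ m i).re =
      2 * Real.pi * (∑ i ∈ s with m i = 0, c i).re := by
    have := Complex.reCLM.intervalIntegral_comp_comm
      (hc.intervalIntegrable (μ := MeasureTheory.volume) 0 (2 * Real.pi))
    rw [hint, Complex.reCLM_apply, Complex.re_ofReal_mul] at this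
    exact this
  have hnn : 0 ≤ ∫ t in (0 : ℝ)..(2 * Real.pi), (∑ i ∈ s, c i * (Circle.exp t : ℂ) ^ m i).re :=
    intervalIntegral.integral_nonneg (by positivity) fun t _ => h _
  rw [hre] at hnn
  exact nonneg_of_mul_nonneg_right hnn (by positivity)

theorem re_constCoeff_nonneg₂ {α : Type*} (s : Finset α) (c : α → ℂ) (m : α → ℤ × ℤ)
    (h : ∀ z : Circle × Circle,
      0 ≤ (∑ i ∈ s, c i * ((z.1 : ℂ) ^ (m i).1 * (z.2 : ℂ) ^ (m i).2)).re) :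
    0 ≤ (∑ i ∈ s with m i = 0, c i).re := by
  have h1 : ∀ w : Circle, 0 ≤ (∑ i ∈ s with (m i).1 = 0, c i * (w : ℂ) ^ (m i).2).re := by
    intro w
    refine re_constCoeff_nonneg s (fun i => c i * (w : ℂ) ^ (m i).2) (fun i => (m i).1) fun z => ?_
    refine (h (z, w)).trans_eq (congrArg _ (Finset.sum_congr rfl fun i _ => ?_))
    simp only
    ring
  have h2 := re_constCoeff_nonneg _ c (fun i => (m i).2) h1
  rw [Finset.filter_filter] at h2
  simpa only [Prod.ext_iff, Prod.fst_zero, Prod.snd_zero] using h2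

/-- Multiplying by minus the conjugate of the constant coefficient `w` keeps the polynomial zero, so
positivity of real parts gives `-|w|² ≥ 0`. -/
theorem constCoeff_eq_zero {α : Type*} (s : Finset α) (c : α → ℂ) (m : α → ℤ × ℤ)
    (h : ∀ z : Circle × Circle,
      ∑ i ∈ s, c i * ((z.1 : ℂ) ^ (m i).1 * (z.2 : ℂ) ^ (m i).2) = 0) :
    ∑ i ∈ s with m i = 0, c i = 0 := by
  set w := ∑ i ∈ s with m i = 0, c i with hw
  have := re_constCoeff_nonneg₂ s (fun i => -(starRingEnd ℂ w) * c i) m fun z => by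
    simp only [mul_assoc, ← Finset.mul_sum, h]
    simp
  rw [← Finset.mul_sum, ← hw, neg_mul, mul_comm, Complex.mul_conj, Complex.neg_re,
    Complex.ofReal_re] at this
  exact Complex.normSq_eq_zero.1 (le_antisymm (by linarith) (Complex.normSq_nonneg _))

open scoped ComplexOrder in
theorem constCoeff_nonneg {α : Type*} (s : Finset α) (c : α → ℂ) (m : α → ℤ × ℤ)
    (h : ∀ z : Circle × Circle,
      0 ≤ ∑ i ∈ s, c i * ((z.1 : ℂ) ^ (m i).1 * (z.2 : ℂ) ^ (m i).2)) :
    0 ≤ ∑ i ∈ s with m i = 0, c i := by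
  -- The values are real, so their product with `ε * I` has zero real part. The signs `ε = 1` and `ε
  -- = -1` force the imaginary part of the constant coefficient to vanish.
  have him : ∀ ε : ℝ, 0 ≤ (ε * Complex.I * ∑ i ∈ s with m i = 0, c i).re := by
    intro ε
    rw [Finset.mul_sum]
    refine re_constCoeff_nonneg₂ s (fun i => ε * Complex.I * c i) m fun z => ?_
    simp only [mul_assoc, ← Finset.mul_sum]
    have := (Complex.nonneg_iff.1 (h z)).2
    simp [← this]
  have h1 := him 1
  have h2 := him (-1)
  simp only [Complex.mul_re, Complex.mul_im, Complex.ofReal_re, Complex.ofReal_im, Complex.I_re,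
    Complex.I_im] at h1 h2
  exact Complex.nonneg_iff.2
    ⟨re_constCoeff_nonneg₂ s c m fun z => (Complex.nonneg_iff.1 (h z)).1, by linarith⟩

end Fourier

/-! ### A trigonometric polynomial is determined by its values. -/

section TrigPoly

variable {H : Type*} [NormedAddCommGroup H] [InnerProductSpace ℂ H]

theorem TrigPoly.eval_apply (Q : TrigPoly H) (z : Circle × Circle) (h : H) :
    Q.eval z h = ∑ k ∈ Q.support, ((z.1 : ℂ) ^ k.1 * (z.2 : ℂ) ^ k.2) • Q k h := by
  simp [TrigPoly.eval, Finsupp.sum]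

theorem TrigPoly.eval_sum {α : Type*} (s : Finset α) (m : α → ℤ × ℤ) (A : α → H →L[ℂ] H)
    (z : Circle × Circle) :
    TrigPoly.eval (∑ i ∈ s, Finsupp.single (m i) (A i)) z =
      ∑ i ∈ s, ((z.1 : ℂ) ^ (m i).1 * (z.2 : ℂ) ^ (m i).2) • A i := by
  rw [TrigPoly.eval, ← Finsupp.sum_finsetSum_index]
  · exact Finset.sum_congr rfl fun i _ => Finsupp.sum_single_index (smul_zero _)
  · intro _; exact smul_zero _
  · intro _ _ _; exact smul_add _ _ _

theorem TrigPoly.eq_of_eval_eq {Q G : TrigPoly H} (h : ∀ z, Q.eval z = G.eval z) : Q = G := by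
  classical
  ext1 d
  ext x
  refine ext_inner_left ℂ fun y => ?_
  set s : Finset (ℤ × ℤ) := Q.support ∪ G.support ∪ {d} with hs
  have hsum : ∀ (R : TrigPoly H), R.support ⊆ s → ∀ z : Circle × Circle,
      inner ℂ y (R.eval z x) = ∑ k ∈ s, inner ℂ y (R k x) * ((z.1 : ℂ) ^ k.1 * (z.2 : ℂ) ^ k.2) := by
    intro R hR z
    rw [TrigPoly.eval_apply, inner_sum, Finset.sum_subset hR]
    · refine Finset.sum_congr rfl fun k _ => ?_
      rw [inner_smul_right, mul_comm]
    · intro k _ hk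
      rw [Finsupp.notMem_support_iff.1 hk]; simp
  have hQ := hsum Q fun k hk => by simp only [hs, Finset.mem_union]; exact Or.inl (Or.inl hk)
  have hG := hsum G fun k hk => by simp only [hs, Finset.mem_union]; exact Or.inl (Or.inr hk)
  -- Division by `z^d` moves the coefficient at `d` to the constant term.
  have key := constCoeff_eq_zero s (fun k => inner ℂ y (Q k x) - inner ℂ y (G k x))
    (fun k => k - d) fun z => by
      have h1 : ∑ k ∈ s, (inner ℂ y (Q k x) - inner ℂ y (G k x)) *
          ((z.1 : ℂ) ^ k.1 * (z.2 : ℂ) ^ k.2) = 0 := by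
        simp only [sub_mul, Finset.sum_sub_distrib]
        rw [← hQ, ← hG, h, sub_self]
      have h2 : ∀ k : ℤ × ℤ, (z.1 : ℂ) ^ (k - d).1 * (z.2 : ℂ) ^ (k - d).2 =
          ((z.1 : ℂ) ^ k.1 * (z.2 : ℂ) ^ k.2) * ((z.1 : ℂ) ^ d.1 * (z.2 : ℂ) ^ d.2)⁻¹ := by
        intro k
        rw [Prod.fst_sub, Prod.snd_sub, zpow_sub₀ z.1.coe_ne_zero, zpow_sub₀ z.2.coe_ne_zero,
          mul_inv]
        ring
      simp only [h2, ← mul_assoc]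
      rw [← Finset.sum_mul]
      simp only [← mul_assoc] at h1
      rw [h1, zero_mul]
  have hfil : s.filter (fun k => k - d = 0) = {d} := by
    ext k
    simp only [hs, Finset.mem_filter, sub_eq_zero, Finset.mem_singleton]
    constructor
    · exact fun hk => hk.2
    · rintro rfl; simp
  rw [hfil, Finset.sum_singleton, sub_eq_zero] at key
  exact key

end TrigPoly

/-! ### Matrix entries of Toeplitz operators, shifts and Gram polynomials. -/

section Entries

variable {H : Type*} [NormedAddCommGroup H] [InnerProductSpace ℂ H]

/-- The monomial `h z^k`, as a bounded operator in `h`. -/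
def monomial (k : ℕ × ℕ) : H →L[ℂ] Hardy H :=
  lp.singleContinuousLinearMap ℂ (fun _ : ℕ × ℕ => H) 2 k

theorem monomial_eq (k : ℕ × ℕ) (h : H) : monomial k h = lp.single 2 k h := rfl

theorem monomial_apply (k j : ℕ × ℕ) (h : H) :
    (monomial k h : Hardy H) j = if j = k then h else 0 := by
  rw [monomial_eq, lp.single_apply, Pi.single_apply]

theorem inner_monomial_left (k : ℕ × ℕ) (h : H) (f : Hardy H) :
    inner ℂ (monomial k h) f = inner ℂ h (f k) :=
  lp.inner_single_left k h f

theorem inner_monomial_monomial (j k : ℕ × ℕ) (g h : H) :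
    inner ℂ (monomial j g : Hardy H) (monomial k h) = if j = k then inner ℂ g h else 0 := by
  rw [inner_monomial_left, monomial_apply]
  split_ifs <;> simp

theorem ext_monomial {X Y : Hardy H →L[ℂ] Hardy H}
    (h : ∀ j k g h, inner ℂ (monomial j g) (X (monomial k h)) =
      inner ℂ (monomial j g) (Y (monomial k h))) : X = Y := by
  refine lp.ext_continuousLinearMap (by norm_num) fun k => ?_
  ext x j
  refine ext_inner_left ℂ fun g => ?_
  have := h j k g x
  rwa [inner_monomial_left, inner_monomial_left] at this

theorem ext_inner_monomial {f g : Hardy H}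
    (h : ∀ j x, inner ℂ (monomial j x) f = inner ℂ (monomial j x) g) : f = g := by
  ext j
  refine ext_inner_left ℂ fun x => ?_
  have := h j x
  rwa [inner_monomial_left, inner_monomial_left] at this

open Classical in
theorem proj_monomial (Λ : Set (ℕ × ℕ)) (k : ℕ × ℕ) (h : H) :
    proj Λ (monomial k h) = if k ∈ Λ then monomial k h else 0 := by
  ext j
  rw [proj_apply]
  by_cases hj : j = k
  · subst hj
    split_ifs <;> simp
  · rw [monomial_apply, if_neg hj]
    split_ifs
    · rw [monomial_apply, if_neg hj]
    · rfl
    · rw [monomial_apply, if_neg hj]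
    · rfl

theorem one_sub_proj (Λ : Set (ℕ × ℕ)) : (1 : Hardy H →L[ℂ] Hardy H) - proj Λ = proj Λᶜ := by
  classical
  ext f j
  change f j - (proj Λ f : Hardy H) j = _
  rw [proj_apply, proj_apply]
  by_cases hj : j ∈ Λ <;> simp [hj]

theorem proj_mul_proj (Λ Γ : Set (ℕ × ℕ)) :
    (proj Λ * proj Γ : Hardy H →L[ℂ] Hardy H) = proj (Λ ∩ Γ) := by
  classical
  ext f j
  rw [mul_apply_eq_comp, proj_apply, proj_apply, proj_apply]
  by_cases hj : j ∈ Λ <;> by_cases hj' : j ∈ Γ <;> simp [hj, hj']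

theorem proj_singleton (c : ℕ × ℕ) (f : Hardy H) : proj {c} f = monomial c (f c) := by
  classical
  ext j
  rw [proj_apply, monomial_apply]
  by_cases hj : j = c
  · subst hj; simp
  · simp [hj]

theorem ι_injective : Function.Injective ι := by
  rintro ⟨a, b⟩ ⟨c, d⟩ h
  simp only [ι, Prod.mk.injEq, Nat.cast_inj] at h
  exact Prod.ext h.1 h.2

theorem ι_sub_eq_sub_iff (j k a b : ℕ × ℕ) : ι b - ι a = ι j - ι k ↔ j + a = k + b := by
  simp only [ι, Prod.ext_iff, Prod.fst_sub, Prod.snd_sub, Prod.fst_add, Prod.snd_add]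
  omega

theorem inner_monomial_toeplitz (Q : TrigPoly H) (j k : ℕ × ℕ) (g h : H) :
    inner ℂ (monomial j g) (toeplitz Q (monomial k h)) = inner ℂ g (Q (ι j - ι k) h) := by
  rw [inner_monomial_left, monomial_eq, toeplitz_single]

theorem toeplitz_monomial {P : TrigPoly H} {s : Finset (ℕ × ℕ)}
    (hP : ∀ k, P k ≠ 0 → k ∈ ι '' (s : Set (ℕ × ℕ))) (k : ℕ × ℕ) (h : H) :
    toeplitz P (monomial k h) = ∑ a ∈ s, monomial (k + a) (P (ι a) h) := by
  ext j
  rw [monomial_eq, toeplitz_single, lp.coeFn_sum, Finset.sum_apply]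
  simp only [monomial_apply]
  by_cases hj : P (ι j - ι k) = 0
  · rw [hj]
    symm
    refine Finset.sum_eq_zero fun a _ => ?_
    split_ifs with hja
    · have : ι a = ι j - ι k := by
        subst hja
        simp only [ι, Prod.ext_iff, Prod.fst_sub, Prod.snd_sub, Prod.fst_add, Prod.snd_add]
        push_cast
        constructor <;> ring
      rw [this, hj, zero_apply]
    · rfl
  · obtain ⟨a, ha, hak⟩ := hP _ hj
    have hjk : j = k + a := by
      simp only [ι, Prod.ext_iff, Prod.fst_sub, Prod.snd_sub, Prod.fst_add, Prod.snd_add] at hak ⊢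
      omega
    rw [← hak, Finset.sum_eq_single a]
    · rw [if_pos hjk]
    · intro b _ hb
      rw [if_neg]
      rintro h'
      exact hb (add_left_cancel (h'.symm.trans hjk))
    · exact fun h' => absurd ha h'

theorem shift_monomial (e k : ℕ × ℕ) (h : H) :
    toeplitz (Finsupp.single (ι e) (1 : H →L[ℂ] H)) (monomial k h) = monomial (k + e) h := by
  rw [toeplitz_monomial (s := {e})]
  · simp
  · intro k hk
    rw [Finsupp.single_apply] at hk
    split_ifs at hk with he
    · exact ⟨e, by simp, he⟩
    · exact absurd rfl hk

variable [CompleteSpace H]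

theorem star_shift_monomial (e k : ℕ × ℕ) (h : H) :
    star (toeplitz (Finsupp.single (ι e) (1 : H →L[ℂ] H))) (monomial k h) =
      if e ≤ k then monomial (k - e) h else 0 := by
  refine ext_inner_monomial fun j x => ?_
  rw [ContinuousLinearMap.star_eq_adjoint, ContinuousLinearMap.adjoint_inner_right, shift_monomial,
    inner_monomial_monomial]
  split_ifs with h1 h2 h2
  · rw [inner_monomial_monomial, if_pos]
    rw [← h1, add_tsub_cancel_right]
  · exact absurd (h1 ▸ le_add_self) h2
  · rw [inner_monomial_monomial, if_neg]
    rintro rfl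
    exact h1 (tsub_add_cancel_of_le h2)
  · rw [inner_zero_right]

theorem inner_shift_conj (X : Hardy H →L[ℂ] Hardy H) (e j k : ℕ × ℕ) (g h : H) :
    inner ℂ (monomial j g) ((toeplitz (Finsupp.single (ι e) (1 : H →L[ℂ] H)) * X *
      star (toeplitz (Finsupp.single (ι e) (1 : H →L[ℂ] H)))) (monomial k h)) =
      if e ≤ j ∧ e ≤ k then inner ℂ (monomial (j - e) g) (X (monomial (k - e) h)) else 0 := by
  rw [mul_apply_eq_comp, mul_apply_eq_comp, ← ContinuousLinearMap.adjoint_inner_left,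
    ← ContinuousLinearMap.star_eq_adjoint, star_shift_monomial, star_shift_monomial]
  by_cases h1 : e ≤ j <;> by_cases h2 : e ≤ k <;> simp [h1, h2]

/-- The Gram polynomial `P(z)^* P(z)`. -/
def gram (s : Finset (ℕ × ℕ)) (P : TrigPoly H) : TrigPoly H :=
  ∑ x ∈ s ×ˢ s, Finsupp.single (ι x.2 - ι x.1) (star (P (ι x.1)) * P (ι x.2))

theorem inner_gram (s : Finset (ℕ × ℕ)) (P : TrigPoly H) (d : ℤ × ℤ) (g h : H) :
    inner ℂ g (gram s P d h) = ∑ x ∈ s ×ˢ s,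
      if ι x.2 - ι x.1 = d then inner ℂ (P (ι x.1) g) (P (ι x.2) h) else 0 := by
  rw [gram, Finsupp.finsetSum_apply, sum_apply, inner_sum]
  refine Finset.sum_congr rfl fun x _ => ?_
  rw [Finsupp.single_apply]
  split_ifs
  · rw [mul_apply_eq_comp, ContinuousLinearMap.star_eq_adjoint,
      ContinuousLinearMap.adjoint_inner_right]
  · simp

omit [CompleteSpace H] in
theorem eq_sum_single {P : TrigPoly H} {s : Finset (ℕ × ℕ)}
    (hP : ∀ k, P k ≠ 0 → k ∈ ι '' (s : Set (ℕ × ℕ))) :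
    P = ∑ a ∈ s, Finsupp.single (ι a) (P (ι a)) := by
  ext1 d
  rw [Finsupp.finsetSum_apply]
  by_cases hd : P d = 0
  · rw [hd]
    symm
    refine Finset.sum_eq_zero fun a _ => ?_
    rw [Finsupp.single_apply]
    split_ifs with h
    · rw [h, hd]
    · rfl
  · obtain ⟨a, ha, rfl⟩ := hP _ hd
    rw [Finset.sum_eq_single a]
    · rw [Finsupp.single_eq_same]
    · intro b _ hb
      rw [Finsupp.single_apply, if_neg (fun h => hb (ι_injective h))]
    · exact fun h => absurd ha h

theorem eval_gram {P : TrigPoly H} {s : Finset (ℕ × ℕ)}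
    (hP : ∀ k, P k ≠ 0 → k ∈ ι '' (s : Set (ℕ × ℕ))) (z : Circle × Circle) :
    (gram s P).eval z = star (P.eval z) * P.eval z := by
  have hPz : P.eval z = ∑ a ∈ s, ((z.1 : ℂ) ^ (ι a).1 * (z.2 : ℂ) ^ (ι a).2) • P (ι a) := by
    conv_lhs => rw [eq_sum_single hP]
    exact TrigPoly.eval_sum s ι _ z
  rw [gram, TrigPoly.eval_sum, hPz, star_sum, Finset.sum_mul_sum, ← Finset.sum_product']
  refine Finset.sum_congr rfl fun x _ => ?_
  rw [star_smul, smul_mul_smul_comm]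
  congr 1
  have hconj : ∀ w : Circle, (starRingEnd ℂ) (w : ℂ) = (w : ℂ)⁻¹ := fun w => by
    rw [← Circle.coe_inv_eq_conj, Circle.coe_inv]
  simp only [star_mul', star_zpow₀, Prod.fst_sub, Prod.snd_sub, zpow_sub₀ (Circle.coe_ne_zero _),
    RCLike.star_def, hconj, inv_zpow]
  field_simp

theorem inner_proj_toeplitz {P : TrigPoly H} {s : Finset (ℕ × ℕ)}
    (hP : ∀ k, P k ≠ 0 → k ∈ ι '' (s : Set (ℕ × ℕ))) (Λ : Set (ℕ × ℕ)) [DecidablePred (· ∈ Λ)]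
    (j k : ℕ × ℕ) (g h : H) :
    inner ℂ (monomial j g) ((star (toeplitz P) * proj Λ * toeplitz P : Hardy H →L[ℂ] Hardy H)
      (monomial k h)) =
      ∑ x ∈ s ×ˢ s, if j + x.1 = k + x.2 ∧ j + x.1 ∈ Λ then
        inner ℂ (P (ι x.1) g) (P (ι x.2) h) else 0 := by
  classical
  rw [mul_apply_eq_comp, mul_apply_eq_comp, ContinuousLinearMap.star_eq_adjoint,
    ContinuousLinearMap.adjoint_inner_right, toeplitz_monomial hP, toeplitz_monomial hP, map_sum,
    sum_inner, Finset.sum_product]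
  refine Finset.sum_congr rfl fun a _ => ?_
  rw [inner_sum]
  refine Finset.sum_congr rfl fun b _ => ?_
  rw [proj_monomial]
  by_cases hab : j + a = k + b
  · by_cases hΛ : k + b ∈ Λ
    · simp [hab, hΛ, inner_monomial_monomial]
    · simp [hab, hΛ]
  · split_ifs <;> simp_all [inner_monomial_monomial]

theorem toeplitz_gram {P : TrigPoly H} {s : Finset (ℕ × ℕ)}
    (hP : ∀ k, P k ≠ 0 → k ∈ ι '' (s : Set (ℕ × ℕ))) :
    toeplitz (gram s P) = star (toeplitz P) * toeplitz P := by
  classical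
  have h1 : (proj Set.univ : Hardy H →L[ℂ] Hardy H) = 1 := by
    ext f j
    rw [proj_apply, if_pos (Set.mem_univ _)]; rfl
  refine ext_monomial fun j k g h => ?_
  have := inner_proj_toeplitz hP Set.univ j k g h
  rw [h1, mul_one] at this
  rw [this, inner_monomial_toeplitz, inner_gram]
  simp only [ι_sub_eq_sub_iff, Set.mem_univ, and_true]

-- For a finitely supported family `f_k` and `F(z) = ∑ f_k z^k`, the number `⟨f, T_Q f⟩` is the
-- constant coefficient of the nonnegative function `⟨F(z), Q(z) F(z)⟩`. Density of finite sums does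
-- the rest.
omit [CompleteSpace H] in
open scoped ComplexOrder in
theorem toeplitz_nonneg {Q : TrigPoly H} (hQ : ∀ z, 0 ≤ Q.eval z) : 0 ≤ toeplitz Q := by
  classical
  have hfin : ∀ (f : ℕ × ℕ → H) (s : Finset (ℕ × ℕ)),
      0 ≤ inner ℂ (∑ j ∈ s, monomial j (f j)) (toeplitz Q (∑ k ∈ s, monomial k (f k))) := by
    intro f s
    have key := constCoeff_nonneg ((s ×ˢ s) ×ˢ Q.support)
      (fun x => inner ℂ (f x.1.1) (Q x.2 (f x.1.2))) (fun x => x.2 - (ι x.1.1 - ι x.1.2))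
      fun z => by
        set F : H := ∑ k ∈ s, ((z.1 : ℂ) ^ (ι k).1 * (z.2 : ℂ) ^ (ι k).2) • f k with hF
        have hp := (ContinuousLinearMap.nonneg_iff_isPositive _).1 (hQ z)
        have h0 : 0 ≤ inner ℂ F (Q.eval z F) := hp.inner_nonneg_right F
        refine h0.trans_eq ?_
        rw [TrigPoly.eval_apply, inner_sum]
        rw [Finset.sum_product_right]
        refine Finset.sum_congr rfl fun m _ => ?_
        rw [hF, map_sum, Finset.smul_sum, sum_inner, Finset.sum_product]
        refine Finset.sum_congr rfl fun j _ => ?_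
        rw [inner_sum]
        refine Finset.sum_congr rfl fun k _ => ?_
        have hconj : ∀ w : Circle, (starRingEnd ℂ) (w : ℂ) = (w : ℂ)⁻¹ := fun w => by
          rw [← Circle.coe_inv_eq_conj, Circle.coe_inv]
        rw [map_smul, inner_smul_left, inner_smul_right, inner_smul_right]
        simp only [map_mul, map_zpow₀, Prod.fst_sub, Prod.snd_sub,
          zpow_sub₀ (Circle.coe_ne_zero _), hconj, inv_zpow]
        field_simp
    refine key.trans_eq ?_
    rw [Finset.sum_filter, Finset.sum_product, Finset.sum_product, map_sum, sum_inner]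
    refine Finset.sum_congr rfl fun j _ => ?_
    rw [inner_sum]
    refine Finset.sum_congr rfl fun k _ => ?_
    rw [inner_monomial_toeplitz]
    simp only [sub_eq_zero]
    rw [Finset.sum_ite_eq']
    split_ifs with hm
    · rfl
    · rw [Finsupp.notMem_support_iff.1 hm]; simp
  have hall : ∀ f : Hardy H, 0 ≤ inner ℂ f (toeplitz Q f) := by
    intro f
    have hs := lp.hasSum_single (E := fun _ : ℕ × ℕ => H) (p := 2) (by norm_num) f
    have hcl : IsClosed {f : Hardy H | 0 ≤ inner ℂ f (toeplitz Q f)} :=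
      isClosed_le continuous_const (by fun_prop)
    exact hcl.mem_of_tendsto hs (Filter.Eventually.of_forall fun s => hfin f s)
  rw [ContinuousLinearMap.nonneg_iff_isPositive, ContinuousLinearMap.isPositive_iff_complex]
  intro f
  have h1 := hall f
  have h2 : inner ℂ (toeplitz Q f) f = inner ℂ f (toeplitz Q f) := by
    rw [← inner_conj_symm]
    exact Complex.conj_eq_iff_im.2 (Complex.nonneg_iff.1 h1).2.symm
  rw [h2]
  obtain ⟨h3, h4⟩ := Complex.nonneg_iff.1 h1
  exact ⟨Complex.ext (by simp) (by simpa using h4), h3⟩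

end Entries

/-! ### Analytic symbols and lower sets. -/

section LowerSets

variable {H : Type*} [NormedAddCommGroup H] [InnerProductSpace ℂ H]

/-- `rect a b` as a finite set. -/
def rectFinset (a b : ℕ) : Finset (ℕ × ℕ) := Finset.range a ×ˢ Finset.range b

theorem mem_rectFinset {a b : ℕ} {k : ℕ × ℕ} : k ∈ rectFinset a b ↔ k.1 < a ∧ k.2 < b := by
  simp [rectFinset]

theorem coe_rectFinset (a b : ℕ) : (rectFinset a b : Set (ℕ × ℕ)) = rect a b := by
  ext k
  rw [Finset.mem_coe, mem_rectFinset]; rfl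

theorem mem_rect {a b : ℕ} {k : ℕ × ℕ} : k ∈ rect a b ↔ k.1 < a ∧ k.2 < b := Iff.rfl

theorem toeplitz_apply {P : TrigPoly H} {s : Finset (ℕ × ℕ)}
    (hP : ∀ k, P k ≠ 0 → k ∈ ι '' (s : Set (ℕ × ℕ))) (f : Hardy H) (j : ℕ × ℕ) :
    (toeplitz P f : Hardy H) j = ∑ a ∈ s, if a ≤ j then P (ι a) (f (j - a)) else 0 := by
  classical
  have h1 : (toeplitz P f : Hardy H) j = ∑ m ∈ P.support, reindexFun {j | 0 ≤ ι j - m}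
        (fun j => ((ι j - m).1.toNat, (ι j - m).2.toNat)) (P m) f j := by
    simp only [toeplitz, Finsupp.sum, sum_apply, lp.coeFn_sum, Finset.sum_apply]
    rfl
  have hsub : P.support ⊆ s.image ι := by
    intro m hm
    obtain ⟨a, ha, rfl⟩ := hP m (Finsupp.mem_support_iff.1 hm)
    exact Finset.mem_image_of_mem _ ha
  rw [h1, Finset.sum_subset hsub, Finset.sum_image ι_injective.injOn]
  · refine Finset.sum_congr rfl fun a _ => ?_
    have hiff : j ∈ {j : ℕ × ℕ | 0 ≤ ι j - ι a} ↔ a ≤ j := by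
      simp only [ι, Set.mem_ofPred_eq, Prod.le_def, Prod.fst_sub, Prod.snd_sub, Prod.fst_zero,
        Prod.snd_zero]
      omega
    by_cases ha : a ≤ j
    · rw [reindexFun, if_pos (hiff.2 ha), if_pos ha]
      refine congrArg (fun i => P (ι a) (f i)) (Prod.ext ?_ ?_) <;>
        simp only [ι, Prod.fst_sub, Prod.snd_sub] <;> omega
    · rw [reindexFun, if_neg (fun h => ha (hiff.1 h)), if_neg ha]
  · intro m _ hm
    rw [Finsupp.notMem_support_iff.1 hm, reindexFun]
    simp

theorem proj_eq_zero_iff (Λ : Set (ℕ × ℕ)) (f : Hardy H) : proj Λ f = 0 ↔ ∀ k ∈ Λ, f k = 0 := by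
  classical
  constructor
  · intro h k hk
    have : (proj Λ f : Hardy H) k = 0 := by rw [h]; rfl
    rwa [proj_apply, if_pos hk] at this
  · intro h
    ext k
    rw [proj_apply]
    split_ifs with hk
    · exact h k hk
    · rfl

section Analytic

variable {P : TrigPoly H} {s : Finset (ℕ × ℕ)}

/-- The coefficient of `P f` at `k` involves only those of `f` at indices below `k`, which stay in a
lower set. -/
theorem proj_toeplitz_eq_zero (hP : ∀ k, P k ≠ 0 → k ∈ ι '' (s : Set (ℕ × ℕ)))
    {Λ : Set (ℕ × ℕ)} (hΛ : IsLowerSet Λ) {f : Hardy H} (hf : proj Λ f = 0) :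
    proj Λ (toeplitz P f) = 0 := by
  rw [proj_eq_zero_iff] at hf ⊢
  intro k hk
  rw [toeplitz_apply hP]
  refine Finset.sum_eq_zero fun a _ => ?_
  rw [hf _ (hΛ tsub_le_self hk), map_zero, ite_self]

theorem proj_mul_toeplitz_mul_proj (hP : ∀ k, P k ≠ 0 → k ∈ ι '' (s : Set (ℕ × ℕ)))
    {Λ : Set (ℕ × ℕ)} (hΛ : IsLowerSet Λ) :
    (proj Λ * toeplitz P * proj Λ : Hardy H →L[ℂ] Hardy H) = proj Λ * toeplitz P := by
  ext1 f
  have h1 : proj Λ (f - proj Λ f) = 0 := by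
    rw [map_sub, sub_eq_zero, ← mul_apply_eq_comp, proj_mul_proj, Set.inter_self]
  have h2 := proj_toeplitz_eq_zero hP hΛ h1
  rw [map_sub, map_sub, sub_eq_zero] at h2
  exact h2.symm

variable [CompleteSpace H]

theorem isSchurComplement_of_rangeCond (hP : ∀ k, P k ≠ 0 → k ∈ ι '' (s : Set (ℕ × ℕ)))
    {Λ : Set (ℕ × ℕ)} (hΛ : IsLowerSet Λ) (hR : RangeCond P Λ Λ) :
    IsSchurComplement (star (toeplitz P) * toeplitz P) (proj Λ)
      (star (toeplitz P) * proj Λ * toeplitz P) := by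
  refine IsSchurComplement.of_approx (q := 1) (proj_isStarProjection Λ) (.one _) (mul_one _) ?_
    (proj_mul_toeplitz_mul_proj hP hΛ) fun f => ?_
  · rw [mul_one]; exact isSchurComplement_one _
  · rw [one_sub_proj]
    refine closure_mono ?_ (hR ⟨f, rfl⟩)
    rintro _ ⟨g, rfl⟩
    refine ⟨proj Λᶜ g, ?_, rfl⟩
    change proj Λ (proj Λᶜ g) = 0
    rw [proj_eq_zero_iff]
    intro k hk
    rw [proj_apply, if_neg (fun h => h hk)]

/-- Removing one point from the support of a Schur complement. -/
theorem isSchurComplement_of_insert (hP : ∀ k, P k ≠ 0 → k ∈ ι '' (s : Set (ℕ × ℕ)))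
    (hran : ∀ a ∈ s, Set.range (P (ι a)) ⊆ closure (Set.range (P 0)))
    {M : Hardy H →L[ℂ] Hardy H} {Λ : Set (ℕ × ℕ)} (hΛ : IsLowerSet Λ) {c : ℕ × ℕ} (hc : c ∉ Λ)
    (hS : IsSchurComplement M (proj (insert c Λ))
      (star (toeplitz P) * proj (insert c Λ) * toeplitz P)) :
    IsSchurComplement M (proj Λ) (star (toeplitz P) * proj Λ * toeplitz P) := by
  classical
  have hdiff : (proj (insert c Λ) - proj Λ : Hardy H →L[ℂ] Hardy H) = proj {c} := by
    ext f j
    change (proj (insert c Λ) f : Hardy H) j - (proj Λ f : Hardy H) j = _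
    rw [proj_apply, proj_apply, proj_apply]
    by_cases hj : j = c
    · subst hj; simp [hc]
    · by_cases hj' : j ∈ Λ <;> simp [hj, hj']
  refine IsSchurComplement.of_approx (proj_isStarProjection Λ) (proj_isStarProjection _) ?_ hS
    (proj_mul_toeplitz_mul_proj hP hΛ) fun f => ?_
  · rw [proj_mul_proj, Set.inter_eq_self_of_subset_left (Set.subset_insert _ _)]
  rw [hdiff]
  -- Each coefficient of `P g` is a sum of vectors from the ranges of the `P_a`, while a monomial at
  -- `c` produces exactly `P_0 h` at `c`. So the row at `c` can be corrected by monomials at `c`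
  -- alone.
  have hy : ∀ g : Hardy H, (toeplitz P g : Hardy H) c ∈ closure (Set.range (P 0)) := by
    intro g
    let L : Submodule ℂ H := (LinearMap.range (P 0 : H →ₗ[ℂ] H)).topologicalClosure
    change _ ∈ L
    rw [toeplitz_apply hP]
    refine L.sum_mem fun a ha => ?_
    split_ifs
    · exact hran a ha ⟨_, rfl⟩
    · exact L.zero_mem
  rw [mul_apply_eq_comp, mul_apply_eq_comp, proj_singleton]
  refine map_mem_closure (monomial c).continuous (hy _) ?_
  rintro _ ⟨h, rfl⟩
  refine ⟨monomial c h, ?_, ?_⟩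
  · change proj Λ (monomial c h) = 0
    rw [proj_monomial, if_neg hc]
  · rw [mul_apply_eq_comp, proj_singleton, monomial_eq c h, toeplitz_single, sub_self]

-- Read the range condition at the corner `c`. For input off `Λ` only `P_0` contributes, since `c -
-- b` lies in `Λ` for every other `b`; the input `h z^{c-a}` contributes `P_a h`.
omit [CompleteSpace H] in
theorem range_coeff_subset {n₁ n₂ : ℕ}
    (hP : ∀ k, P k ≠ 0 → k ∈ ι '' (rectFinset (n₁ + 1) (n₂ + 1) : Set (ℕ × ℕ)))
    (hR : RangeCond P (rect (n₁ + 1) (n₂ + 1) \ {(n₁, n₂)}) (rect (n₁ + 1) (n₂ + 1) \ {(n₁, n₂)})) :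
    ∀ a ∈ rectFinset (n₁ + 1) (n₂ + 1), Set.range (P (ι a)) ⊆ closure (Set.range (P 0)) := by
  classical
  rintro a ha _ ⟨h, rfl⟩
  by_cases ha0 : a = 0
  · subst ha0
    exact subset_closure ⟨h, rfl⟩
  set c : ℕ × ℕ := (n₁, n₂) with hc
  set Λ : Set (ℕ × ℕ) := rect (n₁ + 1) (n₂ + 1) \ {c} with hΛ
  rw [mem_rectFinset] at ha
  have hcΛ : c ∈ Λᶜ := fun h => h.2 rfl
  have hca : c - a ∈ Λ := by
    refine ⟨?_, ?_⟩
    · rw [mem_rect, Prod.fst_sub, Prod.snd_sub]; simp only [hc]; omega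
    · simp only [Prod.ext_iff, Prod.fst_zero, Prod.snd_zero] at ha0
      simp only [hc, Set.mem_singleton_iff, Prod.ext_iff, Prod.fst_sub, Prod.snd_sub]
      omega
  have h1 := hR ⟨monomial (c - a) h, rfl⟩
  have hev : Continuous fun f : Hardy H => f c :=
    (continuous_apply c).comp lp.uniformContinuous_coe.continuous
  have h2 := map_mem_closure hev h1 (t := Set.range (P 0)) (by
    rintro _ ⟨g, rfl⟩
    refine ⟨g c, ?_⟩
    change _ = ((proj Λᶜ * toeplitz P * proj Λᶜ : Hardy H →L[ℂ] Hardy H) g : Hardy H) c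
    rw [mul_apply_eq_comp, mul_apply_eq_comp, proj_apply, if_pos hcΛ, toeplitz_apply hP,
      Finset.sum_eq_single 0]
    · rw [if_pos zero_le, tsub_zero, proj_apply, if_pos hcΛ]; rfl
    · intro b hb hb0
      suffices hz : (proj Λᶜ g : Hardy H) (c - b) = 0 by rw [hz, map_zero, ite_self]
      rw [proj_apply, if_neg]
      rw [Set.notMem_compl_iff]
      rw [mem_rectFinset] at hb
      refine ⟨?_, ?_⟩
      · rw [mem_rect, Prod.fst_sub, Prod.snd_sub]; simp only [hc]; omega
      · simp only [ne_eq, Prod.ext_iff, Prod.fst_zero, Prod.snd_zero] at hb0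
        simp only [hc, Set.mem_singleton_iff, Prod.ext_iff, Prod.fst_sub, Prod.snd_sub]
        omega
    · intro h0
      exact absurd (mem_rectFinset.2 ⟨Nat.succ_pos _, Nat.succ_pos _⟩) h0)
  convert h2 using 1
  change _ = ((proj Λᶜ * toeplitz P * proj Λ : Hardy H →L[ℂ] Hardy H) (monomial (c - a) h) :
    Hardy H) c
  rw [mul_apply_eq_comp, mul_apply_eq_comp, proj_monomial, if_pos hca, proj_apply, if_pos hcΛ,
    monomial_eq, toeplitz_single]
  congr 2
  simp only [ι, hc, Prod.ext_iff, Prod.fst_sub, Prod.snd_sub]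
  omega

end Analytic

/-! ### From a factorization to the two identities. -/

section Forward

variable [CompleteSpace H] {P : TrigPoly H} {n₁ n₂ : ℕ}

theorem isLowerSet_rect (a b : ℕ) : IsLowerSet (rect a b) := by
  intro j k hkj hj
  rw [mem_rect] at hj ⊢
  exact ⟨hkj.1.trans_lt hj.1, hkj.2.trans_lt hj.2⟩

theorem rect_sdiff_corner (n₁ n₂ : ℕ) :
    rect (n₁ + 1) (n₂ + 1) \ {(n₁, n₂)} = rect n₁ (n₂ + 1) ∪ rect (n₁ + 1) n₂ := by
  ext k
  simp only [Set.mem_sdiff, Set.mem_union, mem_rect, Set.mem_singleton_iff, Prod.ext_iff]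
  omega

/-- Downward induction on `m` strips the points `(n₁, m)` from the column `n₁`. At `m = n₂` the set
is `K` without its corner; at `m = 0` it is the rectangle of `S₁`. -/
theorem isSchurComplement_rect
    (hP : ∀ k, P k ≠ 0 → k ∈ ι '' (rectFinset (n₁ + 1) (n₂ + 1) : Set (ℕ × ℕ)))
    (hR : RangeCond P (rect (n₁ + 1) (n₂ + 1) \ {(n₁, n₂)})
      (rect (n₁ + 1) (n₂ + 1) \ {(n₁, n₂)})) {m : ℕ} (hm : m ≤ n₂) :
    IsSchurComplement (star (toeplitz P) * toeplitz P) (proj (rect n₁ (n₂ + 1) ∪ rect (n₁ + 1) m))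
      (star (toeplitz P) * proj (rect n₁ (n₂ + 1) ∪ rect (n₁ + 1) m) * toeplitz P) := by
  induction hm using Nat.decreasingInduction with
  | self =>
    rw [← rect_sdiff_corner]
    refine isSchurComplement_of_rangeCond hP ?_ hR
    rw [rect_sdiff_corner]
    exact (isLowerSet_rect _ _).union (isLowerSet_rect _ _)
  | @of_succ m hm ih =>
    refine isSchurComplement_of_insert hP (range_coeff_subset hP hR) (c := (n₁, m))
      ((isLowerSet_rect _ _).union (isLowerSet_rect _ _)) ?_ ?_
    · simp only [Set.mem_union, mem_rect]
      omega
    · rw [show insert (n₁, m) (rect n₁ (n₂ + 1) ∪ rect (n₁ + 1) m) =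
          rect n₁ (n₂ + 1) ∪ rect (n₁ + 1) (m + 1) by
        ext k
        simp only [Set.mem_insert_iff, Set.mem_union, mem_rect, Prod.ext_iff]
        omega]
      exact ih

theorem schur_eq {E : Type*} [NormedAddCommGroup E] [InnerProductSpace ℂ E] [CompleteSpace E]
    {M p S : E →L[ℂ] E} (h : IsSchurComplement M p S) : schur M p = S := by
  have hex : ∃ S, IsSchurComplement M p S := ⟨S, h⟩
  rw [schur, dif_pos hex]
  exact hex.choose_spec.unique h

omit [CompleteSpace H] in
theorem shift_mul_shift (e e' : ℕ × ℕ) :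
    toeplitz (Finsupp.single (ι e) (1 : H →L[ℂ] H)) *
        toeplitz (Finsupp.single (ι e') (1 : H →L[ℂ] H)) =
      toeplitz (Finsupp.single (ι (e + e')) (1 : H →L[ℂ] H)) := by
  refine ext_monomial fun j k g h => ?_
  rw [mul_apply_eq_comp, shift_monomial, shift_monomial, shift_monomial, add_assoc, add_comm e']

/-- Entry by entry, for `a, b ∈ K` with `j + a = k + b`, this is an identity of indicators. If `j +
a` exceeds `n₁` in the first coordinate, then `j` and `k` both have positive first coordinate, so
the shift by `(1, 0)` detects exactly this overflow; likewise for the second coordinate, and the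
shift by `(1, 1)` restores what was subtracted twice. -/
theorem schur_formula_of_factorization
    (hP : ∀ k, P k ≠ 0 → k ∈ ι '' (rectFinset (n₁ + 1) (n₂ + 1) : Set (ℕ × ℕ))) :
    star (toeplitz P) * proj (rect (n₁ + 1) (n₂ + 1)) * toeplitz P =
      star (toeplitz P) * toeplitz P
      - toeplitz (Finsupp.single (ι (1, 0)) (1 : H →L[ℂ] H)) *
          (star (toeplitz P) * proj (rect n₁ (n₂ + 1))ᶜ * toeplitz P) *
          star (toeplitz (Finsupp.single (ι (1, 0)) (1 : H →L[ℂ] H)))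
      - toeplitz (Finsupp.single (ι (0, 1)) (1 : H →L[ℂ] H)) *
          (star (toeplitz P) * proj (rect (n₁ + 1) n₂)ᶜ * toeplitz P) *
          star (toeplitz (Finsupp.single (ι (0, 1)) (1 : H →L[ℂ] H)))
      + toeplitz (Finsupp.single (ι (1, 1)) (1 : H →L[ℂ] H)) *
          (star (toeplitz P) * proj (rect n₁ n₂)ᶜ * toeplitz P) *
          star (toeplitz (Finsupp.single (ι (1, 1)) (1 : H →L[ℂ] H))) := by
  classical
  refine ext_monomial fun j k g h => ?_
  rw [← toeplitz_gram hP]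
  simp only [add_apply, sub_apply, inner_add_right, inner_sub_right]
  rw [inner_shift_conj, inner_shift_conj, inner_shift_conj, inner_monomial_toeplitz, inner_gram]
  simp only [inner_proj_toeplitz hP, ι_sub_eq_sub_iff]
  have hite : ∀ (p : Prop) [Decidable p] (f : (ℕ × ℕ) × (ℕ × ℕ) → ℂ) (t : Finset _),
      (if p then ∑ x ∈ t, f x else 0) = ∑ x ∈ t, if p then f x else 0 := by
    intro p _ f t
    split_ifs <;> simp
  rw [hite, hite, hite, ← Finset.sum_sub_distrib, ← Finset.sum_sub_distrib,
    ← Finset.sum_add_distrib]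
  refine Finset.sum_congr rfl fun x hx => ?_
  obtain ⟨⟨a₁, a₂⟩, ⟨b₁, b₂⟩⟩ := x
  obtain ⟨j₁, j₂⟩ := j
  obtain ⟨k₁, k₂⟩ := k
  simp only [Finset.mem_product, mem_rectFinset] at hx
  simp only [Prod.mk_add_mk, Prod.mk_sub_mk, Prod.mk_le_mk, Prod.mk.injEq, mem_rect,
    Set.mem_compl_iff]
  generalize (inner ℂ (P (ι (a₁, a₂)) g) (P (ι (b₁, b₂)) h) : ℂ) = w
  split_ifs <;> first | (exfalso; omega) | ring

theorem schur_identities {Q : TrigPoly H}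
    (hP : ∀ k, P k ≠ 0 → k ∈ ι '' (rectFinset (n₁ + 1) (n₂ + 1) : Set (ℕ × ℕ)))
    (hQP : ∀ z, Q.eval z = star (P.eval z) * P.eval z)
    (hR₀ : RangeCond P (rect n₁ n₂) (rect n₁ n₂))
    (hR₂ : RangeCond P (rect (n₁ + 1) n₂) (rect (n₁ + 1) n₂))
    (hRc : RangeCond P (rect (n₁ + 1) (n₂ + 1) \ {(n₁, n₂)})
      (rect (n₁ + 1) (n₂ + 1) \ {(n₁, n₂)}))
    (hRK : RangeCond P (rect (n₁ + 1) (n₂ + 1)) (rect (n₁ + 1) (n₂ + 1))) :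
    schurT Q (rect (n₁ + 1) (n₂ + 1) \ {(n₁, n₂)}) =
        schurT Q (rect n₁ (n₂ + 1)) + schurT Q (rect (n₁ + 1) n₂) - schurT Q (rect n₁ n₂) ∧
      schurT Q (rect (n₁ + 1) (n₂ + 1)) = toeplitz Q
        - toeplitz (Finsupp.single (ι (1, 0)) (1 : H →L[ℂ] H)) *
            (toeplitz Q - schurT Q (rect n₁ (n₂ + 1))) *
            star (toeplitz (Finsupp.single (ι (1, 0)) (1 : H →L[ℂ] H)))
        - toeplitz (Finsupp.single (ι (0, 1)) (1 : H →L[ℂ] H)) *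
            (toeplitz Q - schurT Q (rect (n₁ + 1) n₂)) *
            star (toeplitz (Finsupp.single (ι (0, 1)) (1 : H →L[ℂ] H)))
        + toeplitz (Finsupp.single (ι (1, 1)) (1 : H →L[ℂ] H)) *
            (toeplitz Q - schurT Q (rect n₁ n₂)) *
            star (toeplitz (Finsupp.single (ι (1, 1)) (1 : H →L[ℂ] H))) := by
  classical
  have hQ : toeplitz Q = star (toeplitz P) * toeplitz P := by
    rw [← toeplitz_gram hP]
    exact congrArg toeplitz (TrigPoly.eq_of_eval_eq fun z => by rw [hQP, eval_gram hP])
  have hK := schur_eq (isSchurComplement_of_rangeCond hP (isLowerSet_rect _ _) hRK)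
  have h0 := schur_eq (isSchurComplement_of_rangeCond hP (isLowerSet_rect _ _) hR₀)
  have h2 := schur_eq (isSchurComplement_of_rangeCond hP (isLowerSet_rect _ _) hR₂)
  have hc := schur_eq (isSchurComplement_rect hP hRc le_rfl)
  have h1 := schur_eq (isSchurComplement_rect hP hRc (Nat.zero_le _))
  rw [← rect_sdiff_corner] at hc
  rw [show rect n₁ (n₂ + 1) ∪ rect (n₁ + 1) 0 = rect n₁ (n₂ + 1) by ext k; simp [mem_rect]] at h1
  simp only [schurT, hQ, hK, h0, h1, h2, hc]
  have hcompl : ∀ Λ : Set (ℕ × ℕ), star (toeplitz P) * toeplitz P -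
      star (toeplitz P) * proj Λ * toeplitz P = star (toeplitz P) * proj Λᶜ * toeplitz P := by
    intro Λ
    rw [← one_sub_proj]
    noncomm_ring
  refine ⟨?_, ?_⟩
  -- `K` without its corner is the union of the two rectangles, whose intersection is `rect n₁ n₂`.
  · rw [← add_mul, ← mul_add, ← sub_mul, ← mul_sub]
    congr 2
    ext f j
    change _ = (proj _ f : Hardy H) j + (proj _ f : Hardy H) j - (proj _ f : Hardy H) j
    simp only [proj_apply, Set.mem_sdiff, mem_rect, Set.mem_singleton_iff, Prod.ext_iff]
    split_ifs <;> first | (exfalso; omega) | simp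
  · rw [hcompl, hcompl, hcompl]
    exact schur_formula_of_factorization hP

end Forward

end LowerSets

variable {H : Type*} [NormedAddCommGroup H] [InnerProductSpace ℂ H]

/-! ### Sums along the diagonals of a rectangle. -/

section Diagonal

/-- Shifting both indices by `e` does not change the sum over a diagonal. -/
theorem sum_diagonal_shift (s : Finset (ℕ × ℕ)) (hs : IsLowerSet (s : Set (ℕ × ℕ))) (e : ℕ × ℕ)
    (d : ℤ × ℤ) (F : ℕ × ℕ → ℕ × ℕ → ℂ) (hF : ∀ j k, F j k ≠ 0 → j + e ∈ s ∧ k + e ∈ s) :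
    ∑ y ∈ s ×ˢ s, (if ι y.1 - ι y.2 = d then
        if e ≤ y.1 ∧ e ≤ y.2 then F (y.1 - e) (y.2 - e) else 0 else 0) =
      ∑ y ∈ s ×ˢ s, if ι y.1 - ι y.2 = d then F y.1 y.2 else 0 := by
  have hsub : ∀ j k : ℕ × ℕ, ι (j + e) - ι (k + e) = ι j - ι k := by
    intro j k
    simp only [ι, Prod.ext_iff, Prod.fst_sub, Prod.snd_sub, Prod.fst_add, Prod.snd_add]
    omega
  refine Finset.sum_bij_ne_zero (fun y _ _ => (y.1 - e, y.2 - e)) ?_ ?_ ?_ ?_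
  · rintro ⟨j, k⟩ hy -
    rw [Finset.mem_product] at hy ⊢
    exact ⟨hs tsub_le_self hy.1, hs tsub_le_self hy.2⟩
  · rintro ⟨j, k⟩ - h1 ⟨j', k'⟩ - h2 h
    simp only [ne_eq, ite_eq_right_iff, Classical.not_imp] at h1 h2
    rw [Prod.mk.injEq] at h ⊢
    exact ⟨(tsub_left_inj h1.2.1.1 h2.2.1.1).1 h.1, (tsub_left_inj h1.2.1.2 h2.2.1.2).1 h.2⟩
  · rintro ⟨j, k⟩ - h
    simp only [ne_eq, ite_eq_right_iff, Classical.not_imp] at h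
    obtain ⟨hj, hk⟩ := hF j k h.2
    refine ⟨(j + e, k + e), Finset.mem_product.2 ⟨hj, hk⟩, ?_, ?_⟩
    · rw [if_pos ((hsub j k).trans h.1), if_pos ⟨le_add_self, le_add_self⟩]
      simpa using h.2
    · simp
  · rintro ⟨j, k⟩ - h
    simp only [ne_eq, ite_eq_right_iff, Classical.not_imp] at h
    rw [if_pos h.1, if_pos h.2.1, if_pos]
    rw [← h.1, ← hsub, tsub_add_cancel_of_le h.2.1.1, tsub_add_cancel_of_le h.2.1.2]

/-- Every diagonal of a rectangle contains a unique pair without common positive coordinates. -/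
theorem sum_diagonal_corner {a b : ℕ} {d : ℤ × ℤ} {w : ℂ}
    (hd : w ≠ 0 → d ∈ ι '' (rectFinset a b : Set (ℕ × ℕ)) - ι '' (rectFinset a b : Set (ℕ × ℕ))) :
    ∑ y ∈ rectFinset a b ×ˢ rectFinset a b, (if ι y.1 - ι y.2 = d then
      w - (if ((1, 0) : ℕ × ℕ) ≤ y.1 ∧ (1, 0) ≤ y.2 then w else 0)
        - (if ((0, 1) : ℕ × ℕ) ≤ y.1 ∧ (0, 1) ≤ y.2 then w else 0)
        + (if ((1, 1) : ℕ × ℕ) ≤ y.1 ∧ (1, 1) ≤ y.2 then w else 0) else 0) = w := by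
  by_cases hw : w = 0
  · simp [hw]
  obtain ⟨_, ⟨⟨p₁, p₂⟩, hp, rfl⟩, _, ⟨⟨q₁, q₂⟩, hq, rfl⟩, rfl⟩ := hd hw
  rw [Finset.mem_coe, mem_rectFinset] at hp hq
  simp only at hp hq
  -- The alternating expression is `w` when neither coordinate is positive in both indices, and zero
  -- otherwise. With truncated subtraction, the pair of positive and negative parts of `d` is the
  -- only surviving one.
  rw [Finset.sum_eq_single ((p₁ - q₁, p₂ - q₂), (q₁ - p₁, q₂ - p₂))]
  · simp only [ι, Prod.ext_iff, Prod.fst_sub, Prod.snd_sub, Prod.mk_le_mk]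
    split_ifs <;> first | (exfalso; omega) | ring
  · rintro ⟨⟨j₁, j₂⟩, ⟨k₁, k₂⟩⟩ - hne
    simp only [ι, Prod.ext_iff, Prod.fst_sub, Prod.snd_sub, Prod.mk_le_mk, ne_eq] at hne ⊢
    split_ifs <;> first | (exfalso; omega) | ring
  · intro h
    simp only [Finset.mem_product, mem_rectFinset] at h
    omega

end Diagonal

variable [CompleteSpace H]

theorem reApplyInnerSelf_of_corner {E : Type*} [NormedAddCommGroup E] [InnerProductSpace ℂ E]
    [CompleteSpace E] {X p : E →L[ℂ] E} (hp : IsStarProjection p) (hX : p * X * p = X) {f g : E}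
    (h : p f = p g) : X.reApplyInnerSelf f = X.reApplyInnerSelf g := by
  have key : ∀ f, X.reApplyInnerSelf f = X.reApplyInnerSelf (p f) := by
    intro f
    rw [ContinuousLinearMap.reApplyInnerSelf, ContinuousLinearMap.reApplyInnerSelf]
    nth_rewrite 1 [← hX]
    rw [mul_apply_eq_comp, mul_apply_eq_comp, inner_starProjection_comm hp]
  rw [key f, key g, h]

theorem inner_monomial_corner {X : Hardy H →L[ℂ] Hardy H} {Λ : Set (ℕ × ℕ)}
    (hX : proj Λ * X * proj Λ = X) {j k : ℕ × ℕ} {g h : H}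
    (h0 : inner ℂ (monomial j g) (X (monomial k h)) ≠ 0) : j ∈ Λ ∧ k ∈ Λ := by
  classical
  rw [← hX, mul_apply_eq_comp, mul_apply_eq_comp,
    ← inner_starProjection_comm (proj_isStarProjection Λ), proj_monomial, proj_monomial] at h0
  constructor <;> by_contra hn <;> simp [hn] at h0

theorem norm_sq_eq_proj_add (Λ : Set (ℕ × ℕ)) (f : Hardy H) :
    ‖f‖ ^ 2 = ‖proj Λ f‖ ^ 2 + ‖proj Λᶜ f‖ ^ 2 := by
  have hsum : proj Λ f + proj Λᶜ f = f := by
    rw [← one_sub_proj]; simp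
  have h0 : inner ℂ (proj Λ f) (proj Λᶜ f) = 0 := by
    rw [inner_starProjection_comm (proj_isStarProjection Λ), ← mul_apply_eq_comp, proj_mul_proj,
      Set.inter_compl_self, (proj_eq_zero_iff ∅ f).2 (by simp), inner_zero_right]
  have := norm_add_sq_eq_norm_sq_add_norm_sq_of_inner_eq_zero _ _ h0
  rw [hsum] at this
  nlinarith

/-! ### From the two identities to a factorization. -/

section Converse

variable {n₁ n₂ : ℕ} {Q : TrigPoly H}

theorem isSchurComplement_schurT (hQ : 0 ≤ toeplitz Q) (Λ : Set (ℕ × ℕ)) :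
    IsSchurComplement (toeplitz Q) (proj Λ) (schurT Q Λ) :=
  schur_isSchurComplement hQ (proj_isStarProjection Λ)

/-- The difference of the Schur complements at a set and at the same set without one point
factors through the coefficient at this point. -/
theorem exists_row (hQ : 0 ≤ toeplitz Q) {Λ : Set (ℕ × ℕ)} {c : ℕ × ℕ} :
    ∃ R : Hardy H →L[ℂ] H, R.adjoint ∘L R = schurT Q Λ - schurT Q (Λ \ {c}) ∧
      ∀ f, R f ∈ closure (Set.range (R ∘L monomial c)) := by
  classical
  have hK := isSchurComplement_schurT hQ Λ
  have hc := isSchurComplement_schurT hQ (Λ \ {c})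
  have hnest := IsSchurComplement.nested
    (by rw [proj_mul_proj, Set.inter_eq_self_of_subset_left Set.sdiff_subset])
    (by rw [proj_mul_proj, Set.inter_eq_self_of_subset_right Set.sdiff_subset]) hK hc
  refine exists_adjoint_comp_self_eq (sub_nonneg.2 hnest.1.2) (monomial c) fun f ε hε => ?_
  obtain ⟨g, hg, hlt⟩ := hnest.exists_lt (hK.nonneg hQ) (proj_isStarProjection _) f hε
  rw [proj_eq_zero_iff] at hg
  -- On `Λ` the minimizing `g` lives only at `c`, so it may be replaced by its monomial there, which
  -- the smaller Schur complement does not see.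
  refine ⟨g c, ?_⟩
  have h1 : (schurT Q Λ).reApplyInnerSelf (f - monomial c (g c)) =
      (schurT Q Λ).reApplyInnerSelf (f - g) := by
    refine reApplyInnerSelf_of_corner (proj_isStarProjection Λ) hK.1.1 ?_
    rw [map_sub, map_sub]
    congr 1
    ext k
    rw [proj_apply, proj_apply, monomial_apply]
    split_ifs with hk hkc
    · rw [hkc]
    · exact (hg k ⟨hk, hkc⟩).symm
    · rfl
  have h2 : (schurT Q (Λ \ {c})).reApplyInnerSelf (f - monomial c (g c)) =
      (schurT Q (Λ \ {c})).reApplyInnerSelf f := by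
    refine reApplyInnerSelf_of_corner (proj_isStarProjection _) hc.1.1 ?_
    rw [map_sub, proj_monomial, if_neg (fun h => h.2 rfl), sub_zero]
  have h3 : (schurT Q Λ - schurT Q (Λ \ {c})).reApplyInnerSelf (f - monomial c (g c)) =
      (schurT Q Λ).reApplyInnerSelf (f - monomial c (g c)) -
      (schurT Q (Λ \ {c})).reApplyInnerSelf (f - monomial c (g c)) := by
    simp [ContinuousLinearMap.reApplyInnerSelf, inner_sub_left]
  rw [h3, h1, h2]
  linarith

/-- The polynomial with coefficient `R ∘ monomial (c - a)` at `a`. -/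
def rowPoly (s : Finset (ℕ × ℕ)) (c : ℕ × ℕ) (R : Hardy H →L[ℂ] H) : TrigPoly H :=
  ∑ a ∈ s, Finsupp.single (ι a) (R ∘L monomial (c - a))

omit [CompleteSpace H] in
theorem rowPoly_mem (s : Finset (ℕ × ℕ)) (c : ℕ × ℕ) (R : Hardy H →L[ℂ] H) (k : ℤ × ℤ)
    (hk : rowPoly s c R k ≠ 0) : k ∈ ι '' (s : Set (ℕ × ℕ)) := by
  by_contra hn
  refine hk ?_
  rw [rowPoly, Finsupp.finsetSum_apply]
  refine Finset.sum_eq_zero fun a ha => ?_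
  rw [Finsupp.single_apply, if_neg]
  rintro rfl
  exact hn ⟨a, ha, rfl⟩

omit [CompleteSpace H] in
theorem rowPoly_apply {s : Finset (ℕ × ℕ)} {a : ℕ × ℕ} (ha : a ∈ s) (c : ℕ × ℕ)
    (R : Hardy H →L[ℂ] H) : rowPoly s c R (ι a) = R ∘L monomial (c - a) := by
  rw [rowPoly, Finsupp.finsetSum_apply, Finset.sum_eq_single a]
  · rw [Finsupp.single_eq_same]
  · intro b _ hb
    rw [Finsupp.single_apply, if_neg (fun h => hb (ι_injective h))]
  · exact fun h => absurd ha h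

/-- The reflection `a ↦ c - a` of the rectangle turns the Gram sum with `b - a = d` into the sum of
the entries of `R^* R` on the diagonal `j - k = d`. -/
theorem inner_gram_rowPoly {R : Hardy H →L[ℂ] H} (d : ℤ × ℤ) (g h : H) :
    inner ℂ g (gram (rectFinset (n₁ + 1) (n₂ + 1))
      (rowPoly (rectFinset (n₁ + 1) (n₂ + 1)) (n₁, n₂) R) d h) =
    ∑ y ∈ rectFinset (n₁ + 1) (n₂ + 1) ×ˢ rectFinset (n₁ + 1) (n₂ + 1),
      if ι y.1 - ι y.2 = d then
        inner ℂ (monomial y.1 g) ((R.adjoint ∘L R) (monomial y.2 h)) else 0 := by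
  rw [inner_gram]
  set c : ℕ × ℕ := (n₁, n₂) with hc
  have hmem : ∀ y ∈ rectFinset (n₁ + 1) (n₂ + 1) ×ˢ rectFinset (n₁ + 1) (n₂ + 1),
      (c - y.1, c - y.2) ∈ rectFinset (n₁ + 1) (n₂ + 1) ×ˢ rectFinset (n₁ + 1) (n₂ + 1) := by
    intro y hy
    simp only [Finset.mem_product, mem_rectFinset, hc, Prod.fst_sub, Prod.snd_sub] at hy ⊢
    omega
  have hinv : ∀ y ∈ rectFinset (n₁ + 1) (n₂ + 1) ×ˢ rectFinset (n₁ + 1) (n₂ + 1),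
      (c - (c - y.1), c - (c - y.2)) = y := by
    intro y hy
    simp only [Finset.mem_product, mem_rectFinset] at hy
    simp only [hc, Prod.ext_iff, Prod.fst_sub, Prod.snd_sub]
    omega
  refine Finset.sum_nbij' (fun y => (c - y.1, c - y.2)) (fun y => (c - y.1, c - y.2)) hmem hmem
    hinv hinv fun y hy => ?_
  have hy' := Finset.mem_product.1 hy
  rw [rowPoly_apply hy'.1, rowPoly_apply hy'.2, ContinuousLinearMap.comp_apply,
    ContinuousLinearMap.comp_apply, ContinuousLinearMap.comp_apply,
    ContinuousLinearMap.adjoint_inner_right]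
  have hiff : ι y.2 - ι y.1 = d ↔ ι (c - y.1) - ι (c - y.2) = d := by
    simp only [mem_rectFinset] at hy'
    simp only [ι, hc, Prod.ext_iff, Prod.fst_sub, Prod.snd_sub]
    omega
  simp only [hiff]

theorem eq_gram_rowPoly {R : Hardy H →L[ℂ] H} {N S₀ S₁ S₂ : Hardy H →L[ℂ] Hardy H}
    (hQ : ∀ k, Q k ≠ 0 → k ∈ ι '' (rectFinset (n₁ + 1) (n₂ + 1) : Set (ℕ × ℕ)) -
      ι '' (rectFinset (n₁ + 1) (n₂ + 1) : Set (ℕ × ℕ)))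
    (hS₁ : proj (rect n₁ (n₂ + 1)) * S₁ * proj (rect n₁ (n₂ + 1)) = S₁)
    (hS₂ : proj (rect (n₁ + 1) n₂) * S₂ * proj (rect (n₁ + 1) n₂) = S₂)
    (hS₀ : proj (rect n₁ n₂) * S₀ * proj (rect n₁ n₂) = S₀)
    (hR : R.adjoint ∘L R = N - (S₁ + S₂ - S₀))
    (hN : N = toeplitz Q
        - toeplitz (Finsupp.single (ι (1, 0)) (1 : H →L[ℂ] H)) * (toeplitz Q - S₁) *
            star (toeplitz (Finsupp.single (ι (1, 0)) (1 : H →L[ℂ] H)))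
        - toeplitz (Finsupp.single (ι (0, 1)) (1 : H →L[ℂ] H)) * (toeplitz Q - S₂) *
            star (toeplitz (Finsupp.single (ι (0, 1)) (1 : H →L[ℂ] H)))
        + toeplitz (Finsupp.single (ι (1, 1)) (1 : H →L[ℂ] H)) * (toeplitz Q - S₀) *
            star (toeplitz (Finsupp.single (ι (1, 1)) (1 : H →L[ℂ] H)))) :
    Q = gram (rectFinset (n₁ + 1) (n₂ + 1))
      (rowPoly (rectFinset (n₁ + 1) (n₂ + 1)) (n₁, n₂) R) := by
  classical
  ext1 d
  ext h
  refine ext_inner_left ℂ fun g => ?_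
  rw [inner_gram_rowPoly]
  set s := rectFinset (n₁ + 1) (n₂ + 1) with hs
  have hlow : IsLowerSet (s : Set (ℕ × ℕ)) := by
    rw [hs, coe_rectFinset]; exact isLowerSet_rect _ _
  set w : ℂ := inner ℂ g (Q d h) with hw
  let F : (Hardy H →L[ℂ] Hardy H) → ℕ × ℕ → ℕ × ℕ → ℂ := fun X j k =>
    inner ℂ (monomial j g) (X (monomial k h))
  have h1 := sum_diagonal_shift s hlow (1, 0) d (F S₁) fun j k hjk => by
    have := inner_monomial_corner hS₁ hjk
    simp only [mem_rect] at this
    simp only [hs, mem_rectFinset, Prod.fst_add, Prod.snd_add]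
    omega
  have h2 := sum_diagonal_shift s hlow (0, 1) d (F S₂) fun j k hjk => by
    have := inner_monomial_corner hS₂ hjk
    simp only [mem_rect] at this
    simp only [hs, mem_rectFinset, Prod.fst_add, Prod.snd_add]
    omega
  have h0 := sum_diagonal_shift s hlow (1, 1) d (F S₀) fun j k hjk => by
    have := inner_monomial_corner hS₀ hjk
    simp only [mem_rect] at this
    simp only [hs, mem_rectFinset, Prod.fst_add, Prod.snd_add]
    omega
  have hcorner := sum_diagonal_corner (a := n₁ + 1) (b := n₂ + 1) (d := d) (w := w) fun h0 =>
    hQ d fun hz => h0 (by rw [hw, hz]; simp)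
  have hTQ : ∀ y : (ℕ × ℕ) × (ℕ × ℕ), ι y.1 - ι y.2 = d →
      inner ℂ (monomial y.1 g) (toeplitz Q (monomial y.2 h)) = w := by
    intro y hy
    rw [inner_monomial_toeplitz, hy]
  have hshift : ∀ (e : ℕ × ℕ) (y : (ℕ × ℕ) × (ℕ × ℕ)), ι y.1 - ι y.2 = d → e ≤ y.1 → e ≤ y.2 →
      ι (y.1 - e) - ι (y.2 - e) = d := by
    intro e y hy h1 h2
    rw [← hy]
    have h1' := Prod.le_def.1 h1
    have h2' := Prod.le_def.1 h2
    simp only [ι, Prod.ext_iff, Prod.fst_sub, Prod.snd_sub]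
    omega
  -- Every Toeplitz entry on this diagonal is `w`, whether shifted or not. This separates the corner
  -- count of `w` from the shifted and unshifted `S_i`, which cancel after summation.
  have hterm : ∀ y ∈ s ×ˢ s, (if ι y.1 - ι y.2 = d then
        inner ℂ (monomial y.1 g) ((R.adjoint ∘L R) (monomial y.2 h)) else 0) =
      (if ι y.1 - ι y.2 = d then
        w - (if ((1, 0) : ℕ × ℕ) ≤ y.1 ∧ (1, 0) ≤ y.2 then w else 0)
          - (if ((0, 1) : ℕ × ℕ) ≤ y.1 ∧ (0, 1) ≤ y.2 then w else 0)
          + (if ((1, 1) : ℕ × ℕ) ≤ y.1 ∧ (1, 1) ≤ y.2 then w else 0) else 0)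
      + (if ι y.1 - ι y.2 = d then if ((1, 0) : ℕ × ℕ) ≤ y.1 ∧ (1, 0) ≤ y.2 then
          F S₁ (y.1 - (1, 0)) (y.2 - (1, 0)) else 0 else 0)
      + (if ι y.1 - ι y.2 = d then if ((0, 1) : ℕ × ℕ) ≤ y.1 ∧ (0, 1) ≤ y.2 then
          F S₂ (y.1 - (0, 1)) (y.2 - (0, 1)) else 0 else 0)
      - (if ι y.1 - ι y.2 = d then if ((1, 1) : ℕ × ℕ) ≤ y.1 ∧ (1, 1) ≤ y.2 then
          F S₀ (y.1 - (1, 1)) (y.2 - (1, 1)) else 0 else 0)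
      - ((if ι y.1 - ι y.2 = d then F S₁ y.1 y.2 else 0)
        + (if ι y.1 - ι y.2 = d then F S₂ y.1 y.2 else 0)
        - (if ι y.1 - ι y.2 = d then F S₀ y.1 y.2 else 0)) := by
    intro y _
    by_cases hy : ι y.1 - ι y.2 = d
    · simp only [if_pos hy]
      rw [hR, hN]
      simp only [add_apply, sub_apply, inner_add_right, inner_sub_right]
      rw [inner_shift_conj, inner_shift_conj, inner_shift_conj, hTQ y hy]
      simp only [sub_apply, inner_sub_right]
      have hq : ∀ e : ℕ × ℕ, ∀ z : ℂ, (if e ≤ y.1 ∧ e ≤ y.2 then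
          inner ℂ (monomial (y.1 - e) g) (toeplitz Q (monomial (y.2 - e) h)) - z else 0) =
          (if e ≤ y.1 ∧ e ≤ y.2 then w else 0) - (if e ≤ y.1 ∧ e ≤ y.2 then z else 0) := by
        intro e z
        split_ifs with he
        · rw [hTQ (y.1 - e, y.2 - e) (hshift e y hy he.1 he.2)]
        · rw [sub_zero]
      rw [hq, hq, hq]
      ring
    · simp only [if_neg hy]
      ring
  rw [Finset.sum_congr rfl hterm]
  rw [Finset.sum_sub_distrib, Finset.sum_sub_distrib, Finset.sum_add_distrib,
    Finset.sum_add_distrib, hcorner, h1, h2, h0, Finset.sum_sub_distrib, Finset.sum_add_distrib]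
  ring

/-- Choose `g` off `Λ` so that `‖P (h z^c - g)‖²` nearly attains the Schur complement form, at most
`‖P_0 h‖²`. The coefficient at `c` is exactly `P_0 h`, so less than `ε²` is left for the part
outside `Λ`. -/
theorem rangeCond_corner {P : TrigPoly H} {s : Finset (ℕ × ℕ)}
    (hP : ∀ k, P k ≠ 0 → k ∈ ι '' (s : Set (ℕ × ℕ)))
    (hQP : toeplitz Q = star (toeplitz P) * toeplitz P) (hQ : 0 ≤ toeplitz Q)
    {Λ : Set (ℕ × ℕ)} (hΛ : IsLowerSet Λ) {c : ℕ × ℕ} (hc : c ∈ Λ)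
    (hS : ∀ h, (schurT Q Λ).reApplyInnerSelf (monomial c h) ≤ ‖P 0 h‖ ^ 2) :
    RangeCond P Λ {c} := by
  classical
  rintro _ ⟨f, rfl⟩
  rw [mul_apply_eq_comp, proj_singleton]
  set h : H := f c with hh
  refine Metric.mem_closure_iff.2 fun ε hε => ?_
  have hK := isSchurComplement_schurT hQ Λ
  obtain ⟨g, hg, hlt⟩ := hK.exists_lt hQ (proj_isStarProjection Λ) (monomial c h)
    (pow_pos hε 2)
  have hgc : proj Λᶜ g = g := by
    rw [← one_sub_proj, sub_apply, hg, sub_zero]; rfl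
  refine ⟨_, ⟨g, rfl⟩, ?_⟩
  rw [mul_apply_eq_comp, mul_apply_eq_comp, mul_apply_eq_comp, hgc,
    dist_eq_norm, ← map_sub, ← map_sub]
  set u : Hardy H := monomial c h - g with hu
  nth_rewrite 1 [hQP] at hlt
  rw [reApplyInnerSelf_star_mul, norm_sq_eq_proj_add Λ] at hlt
  have hcoord : (proj Λ (toeplitz P u) : Hardy H) c = P 0 h := by
    rw [hu, map_sub, map_sub, proj_toeplitz_eq_zero hP hΛ hg, sub_zero, proj_apply, if_pos hc,
      monomial_eq, toeplitz_single, sub_self]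
  have hnorm : ‖P 0 h‖ ≤ ‖proj Λ (toeplitz P u)‖ := by
    rw [← hcoord]
    exact lp.norm_apply_le_norm (by norm_num) _ _
  have h1 := hS h
  have h2 := pow_le_pow_left₀ (norm_nonneg _) hnorm 2
  refine lt_of_pow_lt_pow_left₀ 2 hε.le ?_
  linarith

theorem exists_factorization
    (hQ : ∀ k, Q k ≠ 0 → k ∈ ι '' (rectFinset (n₁ + 1) (n₂ + 1) : Set (ℕ × ℕ)) -
      ι '' (rectFinset (n₁ + 1) (n₂ + 1) : Set (ℕ × ℕ)))
    (hpos : ∀ z, 0 ≤ Q.eval z)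
    (hc : schurT Q (rect (n₁ + 1) (n₂ + 1) \ {(n₁, n₂)}) =
        schurT Q (rect n₁ (n₂ + 1)) + schurT Q (rect (n₁ + 1) n₂) - schurT Q (rect n₁ n₂))
    (hK : schurT Q (rect (n₁ + 1) (n₂ + 1)) = toeplitz Q
        - toeplitz (Finsupp.single (ι (1, 0)) (1 : H →L[ℂ] H)) *
            (toeplitz Q - schurT Q (rect n₁ (n₂ + 1))) *
            star (toeplitz (Finsupp.single (ι (1, 0)) (1 : H →L[ℂ] H)))
        - toeplitz (Finsupp.single (ι (0, 1)) (1 : H →L[ℂ] H)) *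
            (toeplitz Q - schurT Q (rect (n₁ + 1) n₂)) *
            star (toeplitz (Finsupp.single (ι (0, 1)) (1 : H →L[ℂ] H)))
        + toeplitz (Finsupp.single (ι (1, 1)) (1 : H →L[ℂ] H)) *
            (toeplitz Q - schurT Q (rect n₁ n₂)) *
            star (toeplitz (Finsupp.single (ι (1, 1)) (1 : H →L[ℂ] H)))) :
    ∃ P : TrigPoly H, (∀ k, P k ≠ 0 → k ∈ ι '' (rectFinset (n₁ + 1) (n₂ + 1) : Set (ℕ × ℕ))) ∧
      (∀ z, Q.eval z = star (P.eval z) * P.eval z) ∧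
      RangeCond P (rect (n₁ + 1) (n₂ + 1)) {(n₁, n₂)} ∧
      ∀ k ∈ rectFinset (n₁ + 1) (n₂ + 1), Set.range (P (ι k)) ⊆ closure (Set.range (P 0)) := by
  classical
  have hT := toeplitz_nonneg hpos
  have hcorner := fun Λ : Set (ℕ × ℕ) => (isSchurComplement_schurT hT Λ).1.1
  obtain ⟨R, hR, hran⟩ := exists_row hT (Λ := rect (n₁ + 1) (n₂ + 1)) (c := (n₁, n₂))
  set P := rowPoly (rectFinset (n₁ + 1) (n₂ + 1)) (n₁, n₂) R with hPdef
  have hP := rowPoly_mem (rectFinset (n₁ + 1) (n₂ + 1)) (n₁, n₂) R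
  have hgram : Q = gram (rectFinset (n₁ + 1) (n₂ + 1)) P :=
    eq_gram_rowPoly hQ (hcorner _) (hcorner _) (hcorner _) (hR.trans (by rw [hc])) hK
  have h0mem : (0 : ℕ × ℕ) ∈ rectFinset (n₁ + 1) (n₂ + 1) :=
    mem_rectFinset.2 ⟨Nat.succ_pos _, Nat.succ_pos _⟩
  have hP0 : P 0 = R ∘L monomial (n₁, n₂) := rowPoly_apply h0mem _ R
  refine ⟨P, hP, fun z => ?_, ?_, ?_⟩
  · rw [← eval_gram hP, ← hgram]
  · refine rangeCond_corner hP ?_ hT (isLowerSet_rect _ _) (by simp [mem_rect]) fun h => ?_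
    · rw [← toeplitz_gram hP, ← hgram]
    -- The Schur complement on `K \ {c}` annihilates monomials at `c`, so there the one on `K`
    -- coincides with `R^* R`.
    · have h1 : schurT Q (rect (n₁ + 1) (n₂ + 1)) (monomial (n₁, n₂) h) =
          (R.adjoint ∘L R) (monomial (n₁, n₂) h) := by
        rw [hR, sub_apply]
        have : schurT Q (rect (n₁ + 1) (n₂ + 1) \ {(n₁, n₂)}) (monomial (n₁, n₂) h) = 0 := by
          rw [← hcorner, mul_apply_eq_comp, proj_monomial, if_neg (fun h => h.2 rfl),
            map_zero]
        rw [this, sub_zero]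
      rw [ContinuousLinearMap.reApplyInnerSelf, h1, ← ContinuousLinearMap.reApplyInnerSelf,
        reApplyInnerSelf_adjoint_comp, hP0]
      rfl
  · rintro k hk _ ⟨x, rfl⟩
    rw [hP0, hPdef, rowPoly_apply hk]
    exact hran _

end Converse

end TwoVarOuter

end

theorem mainTheorem2 {H : Type*} [NormedAddCommGroup H] [InnerProductSpace ℂ H] [CompleteSpace H]
    (n₁ n₂ : ℕ) (K : Set (ℕ × ℕ)) (hK : K = rect (n₁ + 1) (n₂ + 1))
    (Q : TrigPoly H) (hQ : ∀ k, Q k ≠ 0 → k ∈ ι '' K - ι '' K)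
    (hpos : ∀ z, 0 ≤ Q.eval z)
    (S₁ S₂ S₀ T₁ T₂ : Hardy H →L[ℂ] Hardy H)
    (hS₁ : S₁ = schurT Q (rect n₁ (n₂ + 1)))
    (hS₂ : S₂ = schurT Q (rect (n₁ + 1) n₂))
    (hS₀ : S₀ = schurT Q (rect n₁ n₂))
    (hT₁ : T₁ = toeplitz (Finsupp.single (1, 0) 1))
    (hT₂ : T₂ = toeplitz (Finsupp.single (0, 1) 1)) :
    (∀ P : TrigPoly H, (∀ k, P k ≠ 0 → k ∈ ι '' K) →
        (∀ z, Q.eval z = star (P.eval z) * P.eval z) →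
        RangeCond P (rect n₁ n₂) (rect n₁ n₂) →
        RangeCond P (rect (n₁ + 1) n₂) (rect (n₁ + 1) n₂) →
        RangeCond P (K \ {(n₁, n₂)}) (K \ {(n₁, n₂)}) →
        RangeCond P K K →
        schurT Q (K \ {(n₁, n₂)}) = S₁ + S₂ - S₀ ∧
        schurT Q K = toeplitz Q - T₁ * (toeplitz Q - S₁) * star T₁
          - T₂ * (toeplitz Q - S₂) * star T₂
          + T₁ * T₂ * (toeplitz Q - S₀) * star T₂ * star T₁) ∧
    (schurT Q (K \ {(n₁, n₂)}) = S₁ + S₂ - S₀ →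
        schurT Q K = toeplitz Q - T₁ * (toeplitz Q - S₁) * star T₁
          - T₂ * (toeplitz Q - S₂) * star T₂
          + T₁ * T₂ * (toeplitz Q - S₀) * star T₂ * star T₁ →
        ∃ P : TrigPoly H, (∀ k, P k ≠ 0 → k ∈ ι '' K) ∧
          (∀ z, Q.eval z = star (P.eval z) * P.eval z) ∧
          RangeCond P K {(n₁, n₂)} ∧
          ∀ k ∈ K, Set.range (P (ι k)) ⊆ closure (Set.range (P 0))) := by
  have hT₁' : T₁ = toeplitz (Finsupp.single (ι (1, 0)) (1 : H →L[ℂ] H)) := hT₁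
  have hT₂' : T₂ = toeplitz (Finsupp.single (ι (0, 1)) (1 : H →L[ℂ] H)) := hT₂
  have hT : T₁ * T₂ = toeplitz (Finsupp.single (ι (1, 1)) (1 : H →L[ℂ] H)) := by
    rw [hT₁', hT₂', shift_mul_shift]; rfl
  have hTs : ∀ X : Hardy H →L[ℂ] Hardy H,
      T₁ * T₂ * X * star T₂ * star T₁ = T₁ * T₂ * X * star (T₁ * T₂) := fun X => by
    rw [star_mul, ← mul_assoc]
  rw [hTs, hT, hT₁', hT₂', hS₁, hS₂, hS₀]
  rw [← coe_rectFinset] at hK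
  subst hK
  constructor
  · intro P hP hQP h₀ h₂ hc hK
    simp only [coe_rectFinset] at hc hK ⊢
    exact schur_identities hP hQP h₀ h₂ hc hK
  · intro hc hK
    simp only [coe_rectFinset] at hc hK
    obtain ⟨P, hP, hQP, hR, hran⟩ := exists_factorization hQ hpos hc hK
    refine ⟨P, hP, hQP, ?_, hran⟩
    rw [coe_rectFinset]
    exact hR
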